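/- Throughout, rings are commutative with identity and $\otimes=\otimes_C$. Let $C$ be a ring, $\lambda\in C$, and let $A$ be a $C$-algebra. Let $\mathrm{Sh}_C(A)=\mathrm{Sh}_{C,\lambda}(A)=\bigoplus_{k\ge 0}A^{\otimes(k+1)}$ be the shuffle Baxter algebra of weight $\lambda$ on $A$, with Baxter operator $P_A(x_0\otimes\cdots\otimes x_n)=1_A\otimes x_0\otimes\cdots\otimes x_n$ and with the mixed shuffle product: for $x=x_0\otimes x_1\otimes\cdots\otimes x_m$ and $y=y_0\otimes y_1\otimes\cdots\otimes y_n$, $$x\,y=\sum_{(\sigma,T)}\lambda^{|T|}\;x_0y_0\otimes\sigma\bigl((x_1\otimes\cdots\otimes x_m)\otimes(y_1\otimes\cdots\otimes y_n);T\bigr).$$ Here $\sigma$ runs over the permutations of $\{1,\dots,m+n\}$ with $\sigma^{-1}(1)<\cdots<\sigma^{-1}(m)$ and $\sigma^{-1}(m+1)<\cdots<\sigma^{-1}(m+n)$, and $T$ runs over the sets of pairs $(k,k+1)$ with $1\le k<m+n$ and $\sigma(k)\le m<\sigma(k+1)$. With $(u_1,\dots,u_{m+n})=(x_1,\dots,x_m,y_1,\dots,y_n)$,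 the element $\sigma(\,\cdot\,;T)\in A^{\otimes(m+n-|T|)}$ is obtained from $u_{\sigma(1)}\otimes\cdots\otimes u_{\sigma(m+n)}$ by replacing, for each $(k,k+1)\in T$, the symbol $\otimes$ between $u_{\sigma(k)}$ and $u_{\sigma(k+1)}$ by the product of $A$. A Baxter ideal of $\mathrm{Sh}_C(A)$ is an ideal that is stable under $P_A$. Let $I$ be a prime ideal of $A$, and let $\tilde I$ be the Baxter ideal of $\mathrm{Sh}_C(A)$ generated by $I\subseteq A=A^{\otimes 1}\subseteq \mathrm{Sh}_C(A)$, that is, the smallest Baxter ideal containing $I$. Let $\bar\varphi:C\to A/I$ be the structure map of the $C$-algebra $A/I$. Then $\tilde I$ is a prime ideal of $\mathrm{Sh}_C(A)$ if and only if 1. $A/I$ has characteristic zero, and 2. for every $n\ge1$ the $C/\ker\bar\varphi$-module $(A/I)^{\otimes n}$ is torsion-free: if $x\in(A/I)^{\otimes n}$ and $rx=0$ for some $r\in C\setminus\ker\bar\varphi$, then $x=0$. -/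

import Mathlib

open scoped TensorProduct DirectSum

namespace BaxterAlgebra

/-! ### Mixable shuffles -/

/-- An `(m, n)`-mixable shuffle `(σ, T)`, with positions and indices counted from `0`: `σ` is a
permutation of `{0, …, m + n - 1}` such that `σ⁻¹` is increasing on the first `m` indices and on the
last `n` indices, and `T` is a set of admissible pairs for `σ`, the pair `(k, k + 1)` being recorded
by its first entry `k`. The pair `(k, k + 1)` is admissible if `σ k` is one of the first `m` indices
and `σ (k + 1)` is one of the last `n`. -/
structure MixableShuffle (m n : ℕ) where
  σ : Equiv.Perm (Fin (m + n))
  T : Finset (Fin (m + n))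
  mono_left : StrictMono fun i : Fin m => σ.symm (Fin.castAdd n i)
  mono_right : StrictMono fun j : Fin n => σ.symm (Fin.natAdd m j)
  admissible : ∀ k ∈ T, ∃ h : (k : ℕ) + 1 < m + n,
    ((σ k : Fin (m + n)) : ℕ) < m ∧ m ≤ ((σ ⟨k + 1, h⟩ : Fin (m + n)) : ℕ)

namespace MixableShuffle

variable {m n : ℕ}

theorem injective_pair :
    Function.Injective fun s : MixableShuffle m n => (s.σ, s.T) := by
  rintro ⟨σ, T, _, _, _⟩ ⟨σ', T', _, _, _⟩ h
  simp only [Prod.mk.injEq] at h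
  obtain ⟨rfl, rfl⟩ := h
  rfl

noncomputable instance : Fintype (MixableShuffle m n) :=
  Fintype.ofInjective _ injective_pair

theorem blockIdx_lt (s : MixableShuffle m n) (p : Fin (m + n)) :
    (Finset.univ.filter fun q => q < p ∧ q ∉ s.T).card < m + n - s.T.card := by
  have hpos : 0 < m + n := p.pos
  set l : Fin (m + n) := ⟨m + n - 1, by omega⟩ with hl
  have hlT : l ∉ s.T := by
    intro h
    obtain ⟨h1, _⟩ := s.admissible l h
    simp only [hl] at h1
    omega
  have h1 : (Finset.univ.filter fun q => q < p ∧ q ∉ s.T) ⊂ s.Tᶜ := by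
    rw [Finset.ssubset_iff_of_subset]
    · refine ⟨l, by simpa using hlT, ?_⟩
      simp only [Finset.mem_filter, Finset.mem_univ, true_and, not_and]
      intro h
      have := p.isLt
      simp only [hl, Fin.lt_def] at h
      omega
    · intro q hq
      simpa using (Finset.mem_filter.mp hq).2.2
  have h2 := Finset.card_lt_card h1
  rwa [Finset.card_compl, Fintype.card_fin] at h2

/-- Merging each pair `(k, k + 1)` with `k ∈ T` groups the `m + n` positions into `m + n - |T|`
consecutive blocks; `s.block p` is the block of the position `p`. -/
def block (s : MixableShuffle m n) (p : Fin (m + n)) : Fin (m + n - s.T.card) :=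
  ⟨(Finset.univ.filter fun q => q < p ∧ q ∉ s.T).card, s.blockIdx_lt p⟩

/-- The tensor factors of the mixable shuffle product term of `x₀ ⊗ x₁ ⊗ … ⊗ xₘ` and
`y₀ ⊗ y₁ ⊗ … ⊗ yₙ` that belongs to `(σ, T)`: the leading factor is `x₀ y₀`. It is followed by the
factors of `σ (x⁺ ⊗ y⁺; T)`, that is, by `u_{σ(1)}, …, u_{σ(m+n)}` with `u = (x⁺, y⁺)`, where the
factors in the same block are multiplied. -/
def word {A : Type*} [CommRing A] (s : MixableShuffle m n)
    (x : Fin (m + 1) → A) (y : Fin (n + 1) → A) : Fin (m + n - s.T.card + 1) → A :=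
  Fin.cons (x 0 * y 0) fun j =>
    ∏ p ∈ Finset.univ.filter (fun p => s.block p = j),
      (Fin.append (Fin.tail x) (Fin.tail y) : Fin (m + n) → A) (s.σ p)

/-- The position in `s.word x y` to which the factors of `x` go. -/
def left (s : MixableShuffle m n) : Fin (m + 1) → Fin (m + n - s.T.card + 1) :=
  Fin.cons 0 fun i => (s.block (s.σ.symm (Fin.castAdd n i))).succ

/-- The position in `s.word x y` to which the factors of `y` go. -/
def right (s : MixableShuffle m n) : Fin (n + 1) → Fin (m + n - s.T.card + 1) :=
  Fin.cons 0 fun i => (s.block (s.σ.symm (Fin.natAdd m i))).succ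

end MixableShuffle

/-! ### Products along the fibres of a map -/

/-- `push F x j` is the product of the `x i` with `F i = j`. -/
def push {ι κ A : Type*} [Fintype ι] [DecidableEq κ] [CommRing A] (F : ι → κ) (x : ι → A) :
    κ → A :=
  fun j => ∏ i ∈ Finset.univ.filter (fun i => F i = j), x i

section push

variable {ι κ μ A : Type*} [Fintype ι] [DecidableEq κ] [DecidableEq μ] [CommRing A]

theorem push_push [Fintype κ] (H : κ → μ) (F : ι → κ) (x : ι → A) :
    push H (push F x) = push (H ∘ F) x := by
  funext j
  simp only [push]
  rw [Finset.prod_sigma']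
  refine Finset.prod_bij' (fun a _ => a.2) (fun a _ => ⟨F a, a⟩) ?_ ?_ ?_ ?_ ?_ <;>
    simp +contextual

theorem push_mul (F : ι → κ) (x y : ι → A) : push F (x * y) = push F x * push F y := by
  funext j
  simp [push, Finset.prod_mul_distrib]

theorem push_update [DecidableEq ι] (F : ι → κ) (x : ι → A) (i : ι) (a : A) :
    push F (Function.update x i a) = Function.update (push F x) (F i)
      (a * ∏ i' ∈ (Finset.univ.filter fun i' => F i' = F i) \ {i}, x i') := by
  funext j
  rcases eq_or_ne j (F i) with rfl | hj
  · simp only [push, Function.update_self]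
    rw [Finset.prod_update_of_mem (by simp)]
  · simp only [push, Function.update_of_ne hj]
    refine Finset.prod_congr rfl fun i' hi' => ?_
    have : i' ≠ i := by
      rintro rfl
      exact hj (Finset.mem_filter.mp hi').2.symm
    simp [this]

theorem push_sumElim {ι' : Type*} [Fintype ι'] (F : ι → κ) (G : ι' → κ) (u : ι ⊕ ι' → A) :
    push (Sum.elim F G) u = push F (u ∘ Sum.inl) * push G (u ∘ Sum.inr) := by
  funext j
  simp only [push, Pi.mul_apply, Finset.prod_filter]
  rw [Fintype.prod_sum_type]
  rfl

theorem push_id [DecidableEq ι] (x : ι → A) : push (fun i => i) x = x := by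
  funext j
  simp only [push, Finset.prod_filter]
  simp

theorem push_one (F : ι → κ) : push F (1 : ι → A) = 1 := by
  funext j
  simp [push]

end push

theorem MixableShuffle.word_eq {m n : ℕ} {A : Type*} [CommRing A] (s : MixableShuffle m n)
    (x : Fin (m + 1) → A) (y : Fin (n + 1) → A) :
    s.word x y = push s.left x * push s.right y := by
  funext j
  refine Fin.cases ?_ (fun j => ?_) j
  · simp [word, push, left, right, Finset.prod_filter, Fin.prod_univ_succ, Fin.succ_ne_zero]
  · simp only [word, Fin.cons_succ, push, left, right, Finset.prod_filter, Pi.mul_apply]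
    rw [Fin.prod_univ_succ, Fin.prod_univ_succ, ← s.σ.symm.prod_comp, Fin.prod_univ_add]
    simp [Fin.tail, (Fin.succ_ne_zero _).symm]

/-! ### Mixable shuffles as pairs of increasing maps -/

/-- A pair of increasing maps that are jointly surjective and respect the leading positions. -/
structure Stuffle (m n : ℕ) where
  k : ℕ
  F : Fin (m + 1) → Fin (k + 1)
  G : Fin (n + 1) → Fin (k + 1)
  monoF : StrictMono F
  monoG : StrictMono G
  F0 : F 0 = 0
  G0 : G 0 = 0
  surj : ∀ j, (∃ i, F i = j) ∨ ∃ i, G i = j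

namespace Stuffle

variable {m n p : ℕ}

theorem k_le_of (s s' : Stuffle m n) (hF : ∀ i, (s.F i : ℕ) = s'.F i)
    (hG : ∀ i, (s.G i : ℕ) = s'.G i) : s.k ≤ s'.k := by
  rcases s.surj (Fin.last _) with ⟨i, hi⟩ | ⟨i, hi⟩
  · have := hF i
    rw [hi, Fin.val_last] at this
    omega
  · have := hG i
    rw [hi, Fin.val_last] at this
    omega

theorem ext_val {s s' : Stuffle m n} (hF : ∀ i, (s.F i : ℕ) = s'.F i)
    (hG : ∀ i, (s.G i : ℕ) = s'.G i) : s = s' := by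
  have hk : s.k = s'.k := le_antisymm (k_le_of s s' hF hG)
    (k_le_of s' s (fun i => (hF i).symm) fun i => (hG i).symm)
  obtain ⟨k, F, G, _, _, _, _, _⟩ := s
  obtain ⟨k', F', G', _, _, _, _, _⟩ := s'
  dsimp only at hk hF hG
  subst hk
  obtain rfl : F = F' := funext fun i => Fin.ext (hF i)
  obtain rfl : G = G' := funext fun i => Fin.ext (hG i)
  rfl

theorem k_le (s : Stuffle m n) : s.k ≤ m + n := by
  have h : (Finset.univ : Finset (Fin s.k)) ⊆
      (Finset.univ.image fun i : Fin m => s.F i.succ).preimage Fin.succ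
        (Fin.succ_injective _).injOn ∪
      (Finset.univ.image fun i : Fin n => s.G i.succ).preimage Fin.succ
        (Fin.succ_injective _).injOn := by
    intro j _
    simp only [Finset.mem_union, Finset.mem_preimage, Finset.mem_image, Finset.mem_univ, true_and]
    rcases s.surj j.succ with ⟨i, hi⟩ | ⟨i, hi⟩
    · refine Or.inl ?_
      induction i using Fin.cases with
      | zero => rw [s.F0] at hi; exact absurd hi.symm (Fin.succ_ne_zero _)
      | succ i => exact ⟨i, hi⟩
    · refine Or.inr ?_
      induction i using Fin.cases with
      | zero => rw [s.G0] at hi; exact absurd hi.symm (Fin.succ_ne_zero _)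
      | succ i => exact ⟨i, hi⟩
  have h1 := (Finset.card_le_card h).trans (Finset.card_union_le _ _)
  have h2 : ∀ (r : ℕ) (f : Fin r → Fin (s.k + 1)),
      ((Finset.univ.image f).preimage Fin.succ (Fin.succ_injective _).injOn).card ≤ r := by
    intro r f
    rw [← Finset.card_image_of_injective _ (Fin.succ_injective s.k)]
    refine (Finset.card_le_card (t := Finset.univ.image f) ?_).trans ?_
    · exact Finset.image_subset_iff.mpr fun a ha => Finset.mem_preimage.mp ha
    exact Finset.card_image_le.trans (by simp)
  have h3 := h2 _ fun i : Fin m => s.F i.succ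
  have h4 := h2 _ fun i : Fin n => s.G i.succ
  simp only [Finset.card_univ, Fintype.card_fin] at h1
  omega

/-- Exchange of the two maps. -/
def swap (s : Stuffle m n) : Stuffle n m :=
  ⟨s.k, s.G, s.F, s.monoG, s.monoF, s.G0, s.F0, fun j => (s.surj j).symm⟩

end Stuffle

namespace MixableShuffle

variable {m n : ℕ}

theorem block_succ (s : MixableShuffle m n) (p : Fin (m + n)) (h : (p : ℕ) + 1 < m + n) :
    (s.block ⟨p + 1, h⟩ : ℕ) = s.block p + if p ∈ s.T then 0 else 1 := by
  simp only [block]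
  split_ifs with hp
  · rw [add_zero]
    congr 1
    ext q
    simp only [Finset.mem_filter, Finset.mem_univ, true_and, Fin.lt_def]
    refine and_congr_left fun hq => ⟨fun h1 => ?_, fun h1 => by omega⟩
    have : (q : ℕ) ≠ p := fun h2 => hq (by rwa [Fin.ext h2])
    omega
  · rw [← Finset.card_insert_of_notMem (a := p) (by simp)]
    congr 1
    ext q
    simp only [Finset.mem_filter, Finset.mem_univ, true_and, Fin.lt_def, Finset.mem_insert]
    constructor
    · rintro ⟨h1, h2⟩
      by_cases h3 : q = p
      · exact Or.inl h3
      · have : (q : ℕ) ≠ p := fun h4 => h3 (Fin.ext h4)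
        exact Or.inr ⟨by omega, h2⟩
    · rintro (rfl | ⟨h1, h2⟩)
      · exact ⟨by omega, hp⟩
      · exact ⟨by omega, h2⟩

theorem block_zero (s : MixableShuffle m n) (h : 0 < m + n) : (s.block ⟨0, h⟩ : ℕ) = 0 := by
  simp [block, Fin.lt_def]

theorem block_last (s : MixableShuffle m n) (h : 0 < m + n) :
    (s.block ⟨m + n - 1, by omega⟩ : ℕ) + 1 = m + n - s.T.card := by
  have hlT : (⟨m + n - 1, by omega⟩ : Fin (m + n)) ∉ s.T := by
    intro h
    obtain ⟨h1, _⟩ := s.admissible _ h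
    dsimp only at h1
    omega
  simp only [block]
  rw [← Finset.card_insert_of_notMem (a := (⟨m + n - 1, by omega⟩ : Fin (m + n))) (by simp)]
  have : insert (⟨m + n - 1, by omega⟩ : Fin (m + n))
      (Finset.univ.filter fun q => q < (⟨m + n - 1, by omega⟩ : Fin (m + n)) ∧ q ∉ s.T)
      = s.Tᶜ := by
    ext q
    simp only [Finset.mem_filter, Finset.mem_univ, true_and, Fin.lt_def, Finset.mem_insert,
      Finset.mem_compl]
    constructor
    · rintro (rfl | ⟨h1, h2⟩)
      · exact hlT
      · exact h2
    · intro h1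
      by_cases h3 : q = ⟨m + n - 1, by omega⟩
      · exact Or.inl h3
      · have h4 : (q : ℕ) ≠ m + n - 1 := fun h4 => h3 (Fin.ext h4)
        exact Or.inr ⟨by omega, h1⟩
  rw [this, Finset.card_compl, Fintype.card_fin]

theorem exists_block (s : MixableShuffle m n) (j : Fin (m + n - s.T.card)) :
    ∃ p, s.block p = j := by
  have hpos : 0 < m + n := by have := j.isLt; omega
  have key : ∀ r (hr : r < m + n), ∀ i : ℕ, i ≤ (s.block ⟨r, hr⟩ : ℕ) → ∃ p, (s.block p : ℕ) = i := by
    intro r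
    induction r with
    | zero =>
      intro hr i hi
      rw [s.block_zero] at hi
      exact ⟨⟨0, hr⟩, by rw [s.block_zero]; omega⟩
    | succ r ih =>
      intro hr i hi
      have h1 := s.block_succ ⟨r, by omega⟩ hr
      dsimp only at h1
      by_cases h2 : i = s.block ⟨r + 1, hr⟩
      · exact ⟨_, h2.symm⟩
      · refine ih (by omega) i ?_
        split_ifs at h1 <;> omega
  obtain ⟨p, hp⟩ := key (m + n - 1) (by omega) j (by
    have := s.block_last hpos
    have := j.isLt
    omega)
  exact ⟨p, Fin.ext hp⟩

theorem block_mono (s : MixableShuffle m n) : Monotone s.block := by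
  intro p q h
  change (Finset.univ.filter fun r => r < p ∧ r ∉ s.T).card ≤
    (Finset.univ.filter fun r => r < q ∧ r ∉ s.T).card
  refine Finset.card_le_card fun r hr => ?_
  simp only [Finset.mem_filter, Finset.mem_univ, true_and] at hr ⊢
  exact ⟨hr.1.trans_le h, hr.2⟩

theorem block_lt_or (s : MixableShuffle m n) {p q : Fin (m + n)} (h : p < q) :
    s.block p < s.block q ∨
      s.block p = s.block q ∧ ((s.σ p : Fin (m + n)) : ℕ) < m ∧
        m ≤ ((s.σ q : Fin (m + n)) : ℕ) := by
  rcases (s.block_mono h.le).lt_or_eq with h1 | h1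
  · exact Or.inl h1
  refine Or.inr ⟨h1, ?_⟩
  have hp1 : (p : ℕ) + 1 < m + n := by
    have := q.isLt
    rw [Fin.lt_def] at h
    omega
  have h2 := s.block_succ p hp1
  have h3 : s.block ⟨p + 1, hp1⟩ ≤ s.block q := s.block_mono (by
    rw [Fin.lt_def] at h
    rw [Fin.le_def]
    exact h)
  rw [← h1, Fin.le_def] at h3
  have hpT : p ∈ s.T := by
    by_contra hp
    rw [if_neg hp] at h2
    omega
  obtain ⟨_, h4, h5⟩ := s.admissible p hpT
  have hq : q = ⟨p + 1, hp1⟩ := by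
    by_contra hq
    have hq1 : (q : ℕ) ≠ p + 1 := fun h => hq (Fin.ext h)
    rw [Fin.lt_def] at h
    have hp2 : (p : ℕ) + 1 + 1 < m + n := by have := q.isLt; omega
    have h6 := s.block_succ ⟨p + 1, hp1⟩ hp2
    have h7 : s.block ⟨p + 1 + 1, hp2⟩ ≤ s.block q := s.block_mono (by
      rw [Fin.le_def]
      dsimp only
      omega)
    rw [← h1, Fin.le_def] at h7
    have hT : (⟨p + 1, hp1⟩ : Fin (m + n)) ∈ s.T := by
      by_contra hT
      rw [if_neg hT] at h6
      rw [if_pos hpT] at h2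
      dsimp only at h6
      omega
    obtain ⟨_, h8, _⟩ := s.admissible _ hT
    omega
  subst hq
  exact ⟨h4, h5⟩

theorem left_succ (s : MixableShuffle m n) (i : Fin m) :
    s.left i.succ = (s.block (s.σ.symm (Fin.castAdd n i))).succ := rfl

theorem right_succ (s : MixableShuffle m n) (i : Fin n) :
    s.right i.succ = (s.block (s.σ.symm (Fin.natAdd m i))).succ := rfl

theorem strictMono_cons {r k : ℕ} {f : Fin r → Fin k} (hf : StrictMono f) :
    StrictMono (Fin.cons 0 fun i => (f i).succ : Fin (r + 1) → Fin (k + 1)) := by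
  intro a b hab
  induction b using Fin.cases with
  | zero => exact absurd hab (Fin.not_lt_zero _)
  | succ b =>
    induction a using Fin.cases with
    | zero => simp
    | succ a => simpa using hf (by simpa using hab)

/-- The increasing maps that belong to a mixable shuffle. -/
def toStuffle (s : MixableShuffle m n) : Stuffle m n where
  k := m + n - s.T.card
  F := s.left
  G := s.right
  monoF := by
    refine strictMono_cons fun a b hab => ?_
    rcases s.block_lt_or (s.mono_left hab) with h | ⟨_, _, h⟩
    · exact h
    · simp only [Equiv.apply_symm_apply, Fin.val_castAdd] at h
      have := b.isLt
      omega
  monoG := by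
    refine strictMono_cons fun a b hab => ?_
    rcases s.block_lt_or (s.mono_right hab) with h | ⟨_, h, _⟩
    · exact h
    · simp only [Equiv.apply_symm_apply, Fin.val_natAdd] at h
      omega
  F0 := rfl
  G0 := rfl
  surj := by
    intro j
    induction j using Fin.cases with
    | zero => exact Or.inl ⟨0, rfl⟩
    | succ j =>
      obtain ⟨p, rfl⟩ := s.exists_block j
      obtain ⟨q, rfl⟩ := s.σ.symm.surjective p
      induction q using Fin.addCases with
      | left i => exact Or.inl ⟨i.succ, rfl⟩
      | right i => exact Or.inr ⟨i.succ, rfl⟩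

end MixableShuffle

namespace Stuffle

variable {m n : ℕ}

/-- The sorting key of an index. -/
def key (s : Stuffle m n) : Fin (m + n) → ℕ :=
  Fin.append (fun i => 2 * (s.F i.succ : ℕ)) fun i => 2 * (s.G i.succ : ℕ) + 1

theorem key_left (s : Stuffle m n) (i : Fin m) :
    s.key (Fin.castAdd n i) = 2 * (s.F i.succ : ℕ) := by simp [key]

theorem key_right (s : Stuffle m n) (i : Fin n) :
    s.key (Fin.natAdd m i) = 2 * (s.G i.succ : ℕ) + 1 := by simp [key]

theorem key_even (s : Stuffle m n) (i : Fin (m + n)) : s.key i % 2 = 0 ↔ (i : ℕ) < m := by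
  induction i using Fin.addCases with
  | left i => rw [key_left]; simp
  | right i => rw [key_right]; simp

theorem key_injective (s : Stuffle m n) : Function.Injective s.key := by
  intro a b h
  induction a using Fin.addCases with
  | left a =>
    induction b using Fin.addCases with
    | left b =>
      rw [key_left, key_left] at h
      have := s.monoF.injective (Fin.ext (by omega) : s.F a.succ = s.F b.succ)
      rw [Fin.succ_injective _ this]
    | right b => rw [key_left, key_right] at h; omega
  | right a =>
    induction b using Fin.addCases with
    | left b => rw [key_left, key_right] at h; omega
    | right b =>
      rw [key_right, key_right] at h
      have := s.monoG.injective (Fin.ext (by omega) : s.G a.succ = s.G b.succ)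
      rw [Fin.succ_injective _ this]

end Stuffle

namespace MixableShuffle

variable {m n : ℕ}

theorem key_toStuffle (s : MixableShuffle m n) (p : Fin (m + n)) :
    s.toStuffle.key (s.σ p) =
      2 * ((s.block p : ℕ) + 1) + if ((s.σ p : Fin (m + n)) : ℕ) < m then 0 else 1 := by
  obtain ⟨q, rfl⟩ := s.σ.symm.surjective p
  rw [Equiv.apply_symm_apply]
  induction q using Fin.addCases with
  | left i => rw [Stuffle.key_left]; simp [toStuffle, left_succ]
  | right i => rw [Stuffle.key_right]; simp [toStuffle, right_succ]

theorem toStuffle_injective : Function.Injective (toStuffle : MixableShuffle m n → _) := by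
  intro s s' h
  have hm : ∀ t : MixableShuffle m n, StrictMono fun p => t.toStuffle.key (t.σ p) := by
    intro t p q hpq
    dsimp only
    rw [key_toStuffle, key_toStuffle]
    rcases t.block_lt_or hpq with h | ⟨h, h1, h2⟩
    · rw [Fin.lt_def] at h
      split_ifs <;> omega
    · rw [h, if_pos h1, if_neg (by omega)]
      omega
  have h1 : ∀ p, s.toStuffle.key (s.σ p) = s'.toStuffle.key (s'.σ p) := by
    rw [← funext_iff]
    rw [← StrictMono.range_inj (hm s) (hm s')]
    have : ∀ t : MixableShuffle m n, Set.range (fun p => t.toStuffle.key (t.σ p)) =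
        Set.range t.toStuffle.key := fun t => t.σ.surjective.range_comp _
    rw [this, this, h]
  have hσ : s.σ = s'.σ := by
    ext p
    have h2 := h1 p
    rw [h] at h2
    rw [s'.toStuffle.key_injective h2]
  have hb : ∀ p, (s.block p : ℕ) = s'.block p := by
    intro p
    have h2 := h1 p
    rw [key_toStuffle, key_toStuffle, hσ] at h2
    split_ifs at h2 <;> omega
  have hT : ∀ t t' : MixableShuffle m n, (∀ p, (t.block p : ℕ) = t'.block p) → t.T ⊆ t'.T := by
    intro t t' hb p hp
    obtain ⟨h3, _⟩ := t.admissible p hp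
    have h4 := t.block_succ p h3
    have h5 := t'.block_succ p h3
    rw [if_pos hp, hb, hb] at h4
    by_contra h6
    rw [if_neg h6] at h5
    omega
  refine injective_pair ?_
  simp only [Prod.mk.injEq]
  exact ⟨hσ, (hT s s' hb).antisymm (hT s' s fun p => (hb p).symm)⟩

end MixableShuffle

namespace Stuffle

variable {m n : ℕ}

/-- The mixable shuffle that belongs to a pair of increasing maps. -/
def toMixable (s : Stuffle m n) : MixableShuffle m n :=
  have hmono : StrictMono (s.key ∘ Tuple.sort s.key) :=
    (Tuple.monotone_sort s.key).strictMono_of_injective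
      (s.key_injective.comp (Equiv.injective _))
  have hsymm : ∀ i j, s.key i < s.key j →
      (Tuple.sort s.key).symm i < (Tuple.sort s.key).symm j := fun i j h => by
    rw [← hmono.lt_iff_lt]
    simpa using h
  { σ := Tuple.sort s.key
    T := Finset.univ.filter fun p => ∃ h : (p : ℕ) + 1 < m + n,
      s.key (Tuple.sort s.key p) / 2 = s.key (Tuple.sort s.key ⟨p + 1, h⟩) / 2
    mono_left := fun i j hij => hsymm _ _ (by
      rw [key_left, key_left]
      have := s.monoF (Fin.succ_lt_succ_iff.mpr hij)
      rw [Fin.lt_def] at this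
      omega)
    mono_right := fun i j hij => hsymm _ _ (by
      rw [key_right, key_right]
      have := s.monoG (Fin.succ_lt_succ_iff.mpr hij)
      rw [Fin.lt_def] at this
      omega)
    admissible := fun p hp => by
      obtain ⟨h, h1⟩ := (Finset.mem_filter.mp hp).2
      have h2 : s.key (Tuple.sort s.key p) < s.key (Tuple.sort s.key ⟨p + 1, h⟩) :=
        hmono (Fin.lt_def.mpr (Nat.lt_succ_self _))
      refine ⟨h, (s.key_even _).mp (by omega), ?_⟩
      have := (s.key_even (Tuple.sort s.key ⟨p + 1, h⟩)).not.mp (by omega)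
      omega }

theorem key_mono (s : Stuffle m n) : StrictMono fun p => s.key (s.toMixable.σ p) :=
  (Tuple.monotone_sort s.key).strictMono_of_injective (s.key_injective.comp (Equiv.injective _))

theorem exists_key (s : Stuffle m n) {j : ℕ} (h0 : j ≠ 0) (hj : j ≤ s.k) :
    ∃ p, s.key (s.toMixable.σ p) / 2 = j := by
  have hv : ((⟨j, by omega⟩ : Fin (s.k + 1)) : ℕ) = j := rfl
  suffices ∃ q, s.key q / 2 = j by
    obtain ⟨q, hq⟩ := this
    exact ⟨s.toMixable.σ.symm q, by rwa [Equiv.apply_symm_apply]⟩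
  rcases s.surj ⟨j, by omega⟩ with ⟨i, hi⟩ | ⟨i, hi⟩
  · induction i using Fin.cases with
    | zero => rw [s.F0] at hi; exact absurd (congrArg Fin.val hi).symm h0
    | succ i =>
      refine ⟨Fin.castAdd n i, ?_⟩
      rw [key_left, hi, hv]
      omega
  · induction i using Fin.cases with
    | zero => rw [s.G0] at hi; exact absurd (congrArg Fin.val hi).symm h0
    | succ i =>
      refine ⟨Fin.natAdd m i, ?_⟩
      rw [key_right, hi, hv]
      omega

theorem key_pos (s : Stuffle m n) (i : Fin (m + n)) : 1 ≤ s.key i / 2 := by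
  induction i using Fin.addCases with
  | left i =>
    have := s.monoF (Fin.succ_pos i)
    rw [key_left]
    rw [Fin.lt_def] at this
    omega
  | right i =>
    have := s.monoG (Fin.succ_pos i)
    rw [key_right]
    rw [Fin.lt_def] at this
    omega

theorem key_le (s : Stuffle m n) (i : Fin (m + n)) : s.key i / 2 ≤ s.k := by
  induction i using Fin.addCases with
  | left i =>
    have := (s.F i.succ).isLt
    rw [key_left]
    omega
  | right i =>
    have := (s.G i.succ).isLt
    rw [key_right]
    omega

theorem block_toMixable (s : Stuffle m n) (p : Fin (m + n)) :
    s.key (s.toMixable.σ p) / 2 = (s.toMixable.block p : ℕ) + 1 := by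
  have hle : ∀ {p q}, p ≤ q → s.key (s.toMixable.σ p) / 2 ≤ s.key (s.toMixable.σ q) / 2 :=
    fun h => Nat.div_le_div_right (s.key_mono.monotone h)
  obtain ⟨p, hp⟩ := p
  induction p with
  | zero =>
    rw [s.toMixable.block_zero]
    have h1 : 1 ≤ s.k := (s.key_pos _).trans (s.key_le (s.toMixable.σ ⟨0, hp⟩))
    obtain ⟨q, hq⟩ := s.exists_key one_ne_zero h1
    have := s.key_pos (s.toMixable.σ ⟨0, hp⟩)
    have := hle (Fin.le_def.mpr (Nat.zero_le q) : (⟨0, hp⟩ : Fin (m + n)) ≤ q)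
    omega
  | succ p ih =>
    have ih := ih (by omega)
    have h1 := s.toMixable.block_succ ⟨p, by omega⟩ hp
    dsimp only at h1
    have h2 : (⟨p, by omega⟩ : Fin (m + n)) ∈ s.toMixable.T ↔
        s.key (s.toMixable.σ ⟨p, by omega⟩) / 2 = s.key (s.toMixable.σ ⟨p + 1, hp⟩) / 2 := by
      refine ⟨fun h => ?_, fun h => ?_⟩
      · exact (Finset.mem_filter.mp h).2.2
      · exact Finset.mem_filter.mpr ⟨Finset.mem_univ _, hp, h⟩
    rw [h1]
    split_ifs with h3
    · rw [h2] at h3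
      omega
    · rw [h2] at h3
      have h4 := hle (Fin.le_def.mpr (Nat.le_succ p) :
        (⟨p, by omega⟩ : Fin (m + n)) ≤ ⟨p + 1, hp⟩)
      have h5 := s.key_le (s.toMixable.σ ⟨p + 1, hp⟩)
      obtain ⟨q, hq⟩ := s.exists_key
        (j := s.key (s.toMixable.σ ⟨p, by omega⟩) / 2 + 1) (by omega) (by omega)
      have h6 : (⟨p + 1, hp⟩ : Fin (m + n)) ≤ q := by
        by_contra h7
        have := hle (show q ≤ (⟨p, by omega⟩ : Fin (m + n)) by
          rw [Fin.le_def] at h7 ⊢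
          dsimp only at h7 ⊢
          omega)
        omega
      have := hle h6
      omega

theorem toStuffle_toMixable (s : Stuffle m n) : s.toMixable.toStuffle = s := by
  refine ext_val (fun i => ?_) fun i => ?_
  · induction i using Fin.cases with
    | zero => simp [s.F0, s.toMixable.toStuffle.F0]
    | succ i =>
      have h := s.block_toMixable (s.toMixable.σ.symm (Fin.castAdd n i))
      rw [Equiv.apply_symm_apply, key_left] at h
      change ((s.toMixable.block (s.toMixable.σ.symm (Fin.castAdd n i))).succ : ℕ) = _
      rw [Fin.val_succ]
      omega
  · induction i using Fin.cases with
    | zero => simp [s.G0, s.toMixable.toStuffle.G0]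
    | succ i =>
      have h := s.block_toMixable (s.toMixable.σ.symm (Fin.natAdd m i))
      rw [Equiv.apply_symm_apply, key_right] at h
      change ((s.toMixable.block (s.toMixable.σ.symm (Fin.natAdd m i))).succ : ℕ) = _
      rw [Fin.val_succ]
      omega

end Stuffle

/-- Mixable shuffles correspond to pairs of increasing maps. -/
def MixableShuffle.equivStuffle (m n : ℕ) : MixableShuffle m n ≃ Stuffle m n where
  toFun := toStuffle
  invFun := Stuffle.toMixable
  left_inv s := toStuffle_injective s.toStuffle.toStuffle_toMixable
  right_inv := Stuffle.toStuffle_toMixable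

noncomputable instance (m n : ℕ) : Fintype (Stuffle m n) :=
  Fintype.ofEquiv _ (MixableShuffle.equivStuffle m n)

theorem MixableShuffle.card_T_le {m n : ℕ} (s : MixableShuffle m n) : s.T.card ≤ m + n :=
  (Finset.card_le_univ _).trans (by simp)

/-- A triple of increasing maps that are jointly surjective and respect the leading positions. -/
structure Stuffle3 (m n p : ℕ) where
  k : ℕ
  F : Fin (m + 1) → Fin (k + 1)
  G : Fin (n + 1) → Fin (k + 1)
  H : Fin (p + 1) → Fin (k + 1)
  monoF : StrictMono F
  monoG : StrictMono G
  monoH : StrictMono H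
  F0 : F 0 = 0
  G0 : G 0 = 0
  H0 : H 0 = 0
  surj : ∀ j, (∃ i, F i = j) ∨ (∃ i, G i = j) ∨ ∃ i, H i = j

namespace Stuffle3

variable {m n p : ℕ}

/-- Cyclic exchange of the three maps. -/
def rotate (s : Stuffle3 m n p) : Stuffle3 n p m :=
  ⟨s.k, s.G, s.H, s.F, s.monoG, s.monoH, s.monoF, s.G0, s.H0, s.F0, fun j => by
    have := s.surj j
    tauto⟩

/-- The triple of a pair of pairs. -/
def comp (a : Σ s : Stuffle m n, Stuffle s.k p) : Stuffle3 m n p where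
  k := a.2.k
  F := a.2.F ∘ a.1.F
  G := a.2.F ∘ a.1.G
  H := a.2.G
  monoF := a.2.monoF.comp a.1.monoF
  monoG := a.2.monoF.comp a.1.monoG
  monoH := a.2.monoG
  F0 := by simp [a.1.F0, a.2.F0]
  G0 := by simp [a.1.G0, a.2.F0]
  H0 := a.2.G0
  surj := by
    intro j
    rcases a.2.surj j with ⟨i, rfl⟩ | h
    · rcases a.1.surj i with ⟨i, rfl⟩ | ⟨i, rfl⟩
      · exact Or.inl ⟨i, rfl⟩
      · exact Or.inr (Or.inl ⟨i, rfl⟩)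
    · exact Or.inr (Or.inr h)

theorem comp_injective :
    Function.Injective (comp : (Σ s : Stuffle m n, Stuffle s.k p) → Stuffle3 m n p) := by
  rintro ⟨s, t⟩ ⟨s', t'⟩ h
  simp only [comp, Stuffle3.mk.injEq] at h
  obtain ⟨k, F, G, mF, mG, F0, G0, sj⟩ := s
  obtain ⟨k', F', G', mF', mG', F0', G0', sj'⟩ := s'
  obtain ⟨l, H, E, mH, mE, H0, E0, st⟩ := t
  obtain ⟨l', H', E', mH', mE', H0', E0', st'⟩ := t'
  dsimp only at *
  obtain ⟨rfl, h1, h2, h3⟩ := h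
  have h1 := eq_of_heq h1
  have h2 := eq_of_heq h2
  obtain rfl := eq_of_heq h3
  have hr : Set.range H = Set.range H' := by
    ext j
    constructor
    · rintro ⟨i, rfl⟩
      rcases sj i with ⟨i, rfl⟩ | ⟨i, rfl⟩
      · exact ⟨F' i, (congrFun h1 i).symm⟩
      · exact ⟨G' i, (congrFun h2 i).symm⟩
    · rintro ⟨i, rfl⟩
      rcases sj' i with ⟨i, rfl⟩ | ⟨i, rfl⟩
      · exact ⟨F i, congrFun h1 i⟩
      · exact ⟨G i, congrFun h2 i⟩
  obtain rfl : k = k' := by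
    have h4 : (Set.range H).ncard = k + 1 := by
      rw [Set.ncard_range_of_injective mH.injective]; simp
    have h5 : (Set.range H').ncard = k' + 1 := by
      rw [Set.ncard_range_of_injective mH'.injective]; simp
    rw [hr, h5] at h4
    omega
  obtain rfl : H = H' := (StrictMono.range_inj mH mH').mp hr
  obtain rfl : F = F' := mH.injective.comp_left h1
  obtain rfl : G = G' := mH.injective.comp_left h2
  rfl

theorem comp_surjective :
    Function.Surjective (comp : (Σ s : Stuffle m n, Stuffle s.k p) → Stuffle3 m n p) := by
  rintro ⟨l, F, G, E, mF, mG, mE, F0, G0, E0, sj⟩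
  set S : Finset (Fin (l + 1)) := Finset.univ.image F ∪ Finset.univ.image G with hS
  have hF : ∀ i, F i ∈ S := fun i => by simp [hS]
  have hG : ∀ i, G i ∈ S := fun i => by simp [hS]
  have hpos : 0 < S.card := Finset.card_pos.mpr ⟨_, hF 0⟩
  obtain ⟨k, hk⟩ : ∃ k, S.card = k + 1 := ⟨S.card - 1, by omega⟩
  set H : Fin (k + 1) ↪o Fin (l + 1) := S.orderEmbOfFin hk with hH
  have hr : ∀ j, j ∈ S ↔ ∃ i, H i = j := fun j => by
    rw [← Finset.mem_coe, ← Finset.range_orderEmbOfFin S hk]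
    rfl
  choose F' hF' using fun i => (hr _).mp (hF i)
  choose G' hG' using fun i => (hr _).mp (hG i)
  have H0 : H 0 = 0 := by
    have h : H 0 ≤ H (F' 0) := H.monotone (Fin.zero_le _)
    rw [hF', F0] at h
    exact Fin.le_zero_iff.mp h
  refine ⟨⟨⟨k, F', G', fun a b h => ?_, fun a b h => ?_, ?_, ?_, fun j => ?_⟩,
    ⟨l, H, E, H.strictMono, mE, H0, E0, fun j => ?_⟩⟩, ?_⟩
  · rw [← H.lt_iff_lt, hF', hF']; exact mF h
  · rw [← H.lt_iff_lt, hG', hG']; exact mG h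
  · exact H.injective (by rw [hF', F0, H0])
  · exact H.injective (by rw [hG', G0, H0])
  · have h := (hr (H j)).mpr ⟨j, rfl⟩
    simp only [hS, Finset.mem_union, Finset.mem_image, Finset.mem_univ, true_and] at h
    rcases h with ⟨i, hi⟩ | ⟨i, hi⟩
    · exact Or.inl ⟨i, H.injective (by rw [hF', hi])⟩
    · exact Or.inr ⟨i, H.injective (by rw [hG', hi])⟩
  · rcases sj j with ⟨i, rfl⟩ | ⟨i, rfl⟩ | h
    · exact Or.inl ⟨F' i, hF' i⟩
    · exact Or.inl ⟨G' i, hG' i⟩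
    · exact Or.inr h
  · simp only [comp, Stuffle3.mk.injEq, heq_eq_eq, true_and]
    exact ⟨funext hF', funext hG', trivial⟩

/-- Triples of increasing maps correspond to pairs of pairs. -/
noncomputable def compEquiv (m n p : ℕ) :
    (Σ s : Stuffle m n, Stuffle s.k p) ≃ Stuffle3 m n p :=
  Equiv.ofBijective comp ⟨comp_injective, comp_surjective⟩

noncomputable instance : Fintype (Stuffle3 m n p) := Fintype.ofEquiv _ (compEquiv m n p)

/-- Cyclic exchange is a bijection. -/
def rotateEquiv (m n p : ℕ) : Stuffle3 m n p ≃ Stuffle3 n p m where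
  toFun := rotate
  invFun s := s.rotate.rotate
  left_inv _ := rfl
  right_inv _ := rfl

end Stuffle3

/-! ### The shuffle Baxter algebra -/

universe u v

/-- The module `⨁_{k ≥ 0} A^{⊗ (k + 1)}` that underlies the shuffle Baxter algebra of weight `lam`
on `A`. The weight enters through the multiplication. -/
def Sha (C : Type u) [CommRing C] (_lam : C) (A : Type v) [CommRing A] [Algebra C A] :
    Type (max u v) :=
  ⨁ k : ℕ, ⨂[C]^(k + 1) A

namespace Sha

variable {C : Type u} [CommRing C] {lam : C} {A : Type v} [CommRing A] [Algebra C A]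

noncomputable instance : AddCommGroup (Sha C lam A) :=
  inferInstanceAs (AddCommGroup (⨁ k : ℕ, ⨂[C]^(k + 1) A))

noncomputable instance : Module C (Sha C lam A) :=
  inferInstanceAs (Module C (⨁ k : ℕ, ⨂[C]^(k + 1) A))

/-- The inclusion of `A^{⊗ (k + 1)}`. -/
noncomputable def incl (C : Type u) [CommRing C] (lam : C) (A : Type v) [CommRing A] [Algebra C A]
    (k : ℕ) : (⨂[C]^(k + 1) A) →ₗ[C] Sha C lam A :=
  DirectSum.lof C ℕ (fun k => ⨂[C]^(k + 1) A) k

/-- The linear map with given components on the summands `A^{⊗ (k + 1)}`. -/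
noncomputable def ofComponents {N : Type*} [AddCommGroup N] [Module C N]
    (f : ∀ k : ℕ, (⨂[C]^(k + 1) A) →ₗ[C] N) : Sha C lam A →ₗ[C] N :=
  DirectSum.toModule C ℕ N f

theorem ofComponents_incl {N : Type*} [AddCommGroup N] [Module C N]
    (f : ∀ k : ℕ, (⨂[C]^(k + 1) A) →ₗ[C] N) (k : ℕ) (x : ⨂[C]^(k + 1) A) :
    ofComponents f (incl C lam A k x) = f k x :=
  DirectSum.toModule_lof (φ := f) C k x

/-- The pure tensor `x₀ ⊗ x₁ ⊗ … ⊗ xₖ`. -/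
noncomputable def pure (C : Type u) [CommRing C] (lam : C) {A : Type v} [CommRing A] [Algebra C A]
    {k : ℕ} (x : Fin (k + 1) → A) : Sha C lam A :=
  incl C lam A k (PiTensorProduct.tprod C x)

theorem induction {motive : Sha C lam A → Prop} (x : Sha C lam A)
    (hpure : ∀ (k : ℕ) (x : Fin (k + 1) → A), motive (pure C lam x))
    (hsmul : ∀ (c : C) (x : Sha C lam A), motive x → motive (c • x))
    (hadd : ∀ x y : Sha C lam A, motive x → motive y → motive (x + y)) : motive x := by
  have h0 : motive 0 := by
    simpa using hsmul 0 _ (hpure 0 0)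
  refine DirectSum.induction_on (motive := motive) x h0 (fun k z => ?_) hadd
  change motive (incl C lam A k z)
  refine PiTensorProduct.induction_on z (fun c f => ?_) fun a b ha hb => ?_
  · rw [map_smul]
    exact hsmul c _ (hpure k f)
  · rw [map_add]
    exact hadd _ _ ha hb

/-- The `C`-multilinear map that sends `x₀, …, xₘ, y₀, …, yₙ` to the pure tensor with the factors
`s.word x y`. -/
noncomputable def wordTensor (C : Type u) [CommRing C] (A : Type v) [CommRing A] [Algebra C A]
    {m n : ℕ} (s : MixableShuffle m n) :
    MultilinearMap C (fun _ : Fin (m + 1) ⊕ Fin (n + 1) => A)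
      (⨂[C]^(m + n - s.T.card + 1) A) where
  toFun u := PiTensorProduct.tprod C (s.word (u ∘ Sum.inl) (u ∘ Sum.inr))
  map_update_add' u i a b := by
    simp only [s.word_eq, ← push_sumElim, push_update, add_mul, MultilinearMap.map_update_add]
  map_update_smul' u i c a := by
    simp only [s.word_eq, ← push_sumElim, push_update, smul_mul_assoc,
      MultilinearMap.map_update_smul]

/-- The mixed shuffle product on `A^{⊗ (m + 1)} × A^{⊗ (n + 1)}`. -/
noncomputable def mulComp (C : Type u) [CommRing C] (lam : C) (A : Type v) [CommRing A]
    [Algebra C A] (m n : ℕ) :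
    (⨂[C]^(m + 1) A) →ₗ[C] (⨂[C]^(n + 1) A) →ₗ[C] Sha C lam A :=
  PiTensorProduct.lift
    (PiTensorProduct.lift.toLinearMap.compMultilinearMap
      (∑ s : MixableShuffle m n, lam ^ s.T.card •
        (incl C lam A _).compMultilinearMap (wordTensor C A s)).currySum)

/-- The mixed shuffle product as a bilinear map. -/
noncomputable def mulHom (C : Type u) [CommRing C] (lam : C) (A : Type v) [CommRing A]
    [Algebra C A] : Sha C lam A →ₗ[C] Sha C lam A →ₗ[C] Sha C lam A :=
  ofComponents fun m => (ofComponents fun n => (mulComp C lam A m n).flip).flip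

theorem mulHom_incl {m n : ℕ} (x : ⨂[C]^(m + 1) A) (y : ⨂[C]^(n + 1) A) :
    mulHom C lam A (incl C lam A m x) (incl C lam A n y) = mulComp C lam A m n x y := by
  rw [mulHom, ofComponents_incl, LinearMap.flip_apply, ofComponents_incl, LinearMap.flip_apply]

noncomputable instance : Mul (Sha C lam A) := ⟨fun x y => mulHom C lam A x y⟩

noncomputable instance : One (Sha C lam A) := ⟨pure C lam (k := 0) fun _ => 1⟩

theorem mul_def (x y : Sha C lam A) : x * y = mulHom C lam A x y := rfl

theorem one_def : (1 : Sha C lam A) = pure C lam (k := 0) fun _ => 1 := rfl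

/-- The formula for the mixed shuffle product:
`x y = ∑_{(σ, T)} lam ^ |T| • x₀ y₀ ⊗ σ (x⁺ ⊗ y⁺; T)`. -/
theorem pure_mul_pure {m n : ℕ} (x : Fin (m + 1) → A) (y : Fin (n + 1) → A) :
    (pure C lam x * pure C lam y : Sha C lam A) =
      ∑ s : MixableShuffle m n, lam ^ s.T.card • pure C lam (s.word x y) := by
  rw [mul_def, pure, pure, mulHom_incl]
  simp only [mulComp, PiTensorProduct.lift.tprod, LinearMap.compMultilinearMap_apply,
    LinearEquiv.coe_coe, MultilinearMap.currySum_apply', sum_apply, smul_apply]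
  rfl

/-- The formula for the product in terms of pairs of increasing maps. -/
theorem pure_mul_pure_stuffle {m n : ℕ} (x : Fin (m + 1) → A) (y : Fin (n + 1) → A) :
    (pure C lam x * pure C lam y : Sha C lam A) =
      ∑ s : Stuffle m n, lam ^ (m + n - s.k) • pure C lam (push s.F x * push s.G y) := by
  rw [pure_mul_pure, ← (MixableShuffle.equivStuffle m n).sum_comp]
  refine Finset.sum_congr rfl fun s _ => ?_
  have h := s.card_T_le
  have h1 : m + n - (MixableShuffle.equivStuffle m n s).k = s.T.card := by
    change m + n - (m + n - s.T.card) = _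
    omega
  rw [h1, s.word_eq]
  rfl

protected theorem add_mul (x y z : Sha C lam A) : (x + y) * z = x * z + y * z := by
  simp [mul_def]

protected theorem mul_add (x y z : Sha C lam A) : x * (y + z) = x * y + x * z := by
  simp [mul_def]

protected theorem smul_mul (c : C) (x y : Sha C lam A) : (c • x) * y = c • (x * y) := by
  simp [mul_def]

protected theorem mul_smul (c : C) (x y : Sha C lam A) : x * (c • y) = c • (x * y) := by
  simp [mul_def]

protected theorem sum_mul {ι : Type*} (s : Finset ι) (f : ι → Sha C lam A) (y : Sha C lam A) :
    (∑ i ∈ s, f i) * y = ∑ i ∈ s, f i * y := by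
  simp [mul_def]

protected theorem mul_comm (x y : Sha C lam A) : x * y = y * x := by
  induction x using Sha.induction with
  | hsmul c x hx => rw [Sha.smul_mul, Sha.mul_smul, hx]
  | hadd x x' hx hx' => rw [Sha.add_mul, Sha.mul_add, hx, hx']
  | hpure m x =>
    induction y using Sha.induction with
    | hsmul c y hy => rw [Sha.smul_mul, Sha.mul_smul, hy]
    | hadd y y' hy hy' => rw [Sha.add_mul, Sha.mul_add, hy, hy']
    | hpure n y =>
      rw [pure_mul_pure_stuffle, pure_mul_pure_stuffle]
      refine Fintype.sum_equiv (⟨Stuffle.swap, Stuffle.swap, fun _ => rfl, fun _ => rfl⟩ :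
        Stuffle m n ≃ Stuffle n m) _ _ fun s => ?_
      change _ = (lam ^ (n + m - s.k) • pure C lam (push s.G y * push s.F x) : Sha C lam A)
      rw [add_comm n m, mul_comm (push s.G y)]

theorem pure_mul_pure_mul_pure {m n p : ℕ} (x : Fin (m + 1) → A) (y : Fin (n + 1) → A)
    (z : Fin (p + 1) → A) :
    (pure C lam x * pure C lam y * pure C lam z : Sha C lam A) =
      ∑ s : Stuffle3 m n p,
        lam ^ (m + n + p - s.k) • pure C lam (push s.F x * push s.G y * push s.H z) := by
  rw [pure_mul_pure_stuffle, Sha.sum_mul, ← (Stuffle3.compEquiv m n p).sum_comp,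
    Fintype.sum_sigma]
  refine Finset.sum_congr rfl fun s _ => ?_
  rw [Sha.smul_mul, pure_mul_pure_stuffle, Finset.smul_sum]
  refine Finset.sum_congr rfl fun t _ => ?_
  have h1 := s.k_le
  have h2 := t.k_le
  rw [smul_smul, ← pow_add, push_mul, push_push, push_push]
  change _ = lam ^ (m + n + p - t.k) • _
  rw [show m + n - s.k + (s.k + p - t.k) = m + n + p - t.k by omega]
  rfl

protected theorem mul_assoc (x y z : Sha C lam A) : x * y * z = x * (y * z) := by
  rw [Sha.mul_comm x (y * z)]
  induction x using Sha.induction with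
  | hsmul c x hx => simp only [Sha.smul_mul, Sha.mul_smul, hx]
  | hadd x x' hx hx' => simp only [Sha.add_mul, Sha.mul_add, hx, hx']
  | hpure m x =>
    induction y using Sha.induction with
    | hsmul c y hy => simp only [Sha.smul_mul, Sha.mul_smul, hy]
    | hadd y y' hy hy' => simp only [Sha.add_mul, Sha.mul_add, hy, hy']
    | hpure n y =>
      induction z using Sha.induction with
      | hsmul c z hz => simp only [Sha.smul_mul, Sha.mul_smul, hz]
      | hadd z z' hz hz' => simp only [Sha.add_mul, Sha.mul_add, hz, hz']
      | hpure p z =>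
        rw [pure_mul_pure_mul_pure, pure_mul_pure_mul_pure]
        refine Fintype.sum_equiv (Stuffle3.rotateEquiv m n p) _ _ fun s => ?_
        change _ = (lam ^ (n + p + m - s.k) •
          pure C lam (push s.G y * push s.H z * push s.F x) : Sha C lam A)
        rw [show n + p + m = m + n + p by omega, mul_assoc, mul_comm (push s.F x)]

protected theorem one_mul (x : Sha C lam A) : 1 * x = x := by
  induction x using Sha.induction with
  | hsmul c x hx => rw [Sha.mul_smul, hx]
  | hadd x x' hx hx' => rw [Sha.mul_add, hx, hx']
  | hpure n x =>
    have hsub : ∀ i : Fin (0 + 1), i = 0 := fun i => Fin.ext (by omega)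
    have h0 : ∀ {k : ℕ} (f : Fin (0 + 1) → Fin k), StrictMono f := fun f a b hab =>
      absurd hab (by rw [hsub a, hsub b]; exact lt_irrefl _)
    let e : Stuffle 0 n := ⟨n, fun _ => 0, fun i => i, h0 _, strictMono_id,
      rfl, rfl, fun j => Or.inr ⟨j, rfl⟩⟩
    have he : ∀ s : Stuffle 0 n, s = e := by
      rintro ⟨k, F, G, mF, mG, F0, G0, sj⟩
      have hs : Function.Surjective G := fun j => by
        rcases sj j with ⟨i, rfl⟩ | h
        · exact ⟨0, by rw [hsub i, F0, G0]⟩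
        · exact h
      have hk := Fintype.card_of_bijective ⟨mG.injective, hs⟩
      simp only [Fintype.card_fin, Nat.add_right_cancel_iff] at hk
      subst hk
      obtain rfl : G = fun i => i := by
        refine (StrictMono.range_inj mG strictMono_id).mp ?_
        rw [hs.range_eq, Set.range_id]
      obtain rfl : F = fun _ => 0 := funext fun i => by rw [hsub i, F0]
      rfl
    rw [one_def, pure_mul_pure_stuffle, Fintype.sum_eq_single e fun s hs => absurd (he s) hs]
    have h1 : push e.F (fun _ => (1 : A)) = 1 := push_one _
    have h2 : push e.G x = x := push_id x
    rw [h1, h2, one_mul]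
    simp [e]

/-- The shuffle Baxter algebra is a commutative ring. -/
noncomputable instance : CommRing (Sha C lam A) where
  __ := (inferInstance : AddCommGroup (Sha C lam A))
  left_distrib := Sha.mul_add
  right_distrib := Sha.add_mul
  zero_mul x := by simp [mul_def]
  mul_zero x := by simp [mul_def]
  mul_assoc := Sha.mul_assoc
  one_mul := Sha.one_mul
  mul_one x := by rw [Sha.mul_comm, Sha.one_mul]
  mul_comm := Sha.mul_comm

noncomputable instance : Algebra C (Sha C lam A) :=
  Algebra.ofModule Sha.smul_mul Sha.mul_smul

/-- The Baxter operator `x₀ ⊗ … ⊗ xₖ ↦ 1 ⊗ x₀ ⊗ … ⊗ xₖ`. -/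
noncomputable def P (C : Type u) [CommRing C] (lam : C) (A : Type v) [CommRing A] [Algebra C A] :
    Sha C lam A →ₗ[C] Sha C lam A :=
  ofComponents fun k => incl C lam A (k + 1) ∘ₗ
    PiTensorProduct.lift
      ((PiTensorProduct.tprod C : MultilinearMap C (fun _ : Fin (k + 1 + 1) => A) _).curryLeft 1)

theorem P_pure {k : ℕ} (x : Fin (k + 1) → A) :
    P C lam A (pure C lam x) = pure C lam (k := k + 1) (Fin.cons 1 x) := by
  rw [P, pure, ofComponents_incl, LinearMap.comp_apply, PiTensorProduct.lift.tprod,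
    MultilinearMap.curryLeft_apply, pure]

/-- The canonical inclusion of `A` as the summand `A^{⊗ 1}`. -/
noncomputable def j (C : Type u) [CommRing C] (lam : C) {A : Type v} [CommRing A] [Algebra C A]
    (a : A) : Sha C lam A :=
  pure C lam (k := 0) fun _ => a

end Sha

/-! ### Baxter ideals and torsion -/

/-- A Baxter ideal of `(R, P)` is an ideal that is stable under `P`. -/
def IsBaxterIdeal {R : Type*} [CommRing R] (P : R → R) (J : Ideal R) : Prop :=
  ∀ x ∈ J, P x ∈ J

/-- The Baxter ideal of `(R, P)` generated by a set `S`: the smallest Baxter ideal that contains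
`S`. -/
def baxterIdealSpan {R : Type*} [CommRing R] (P : R → R) (S : Set R) : Ideal R :=
  sInf {J : Ideal R | IsBaxterIdeal P J ∧ S ⊆ J}

theorem isBaxterIdeal_baxterIdealSpan {R : Type*} [CommRing R] (P : R → R) (S : Set R) :
    IsBaxterIdeal P (baxterIdealSpan P S) := by
  intro x hx
  rw [baxterIdealSpan, Submodule.mem_sInf] at hx ⊢
  exact fun J hJ => hJ.1 x (hx J hJ)

theorem subset_baxterIdealSpan {R : Type*} [CommRing R] (P : R → R) (S : Set R) :
    S ⊆ baxterIdealSpan P S := by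
  intro x hx
  rw [SetLike.mem_coe, baxterIdealSpan, Submodule.mem_sInf]
  exact fun J hJ => hJ.2 hx

/-- The torsion of a `C`-module `N` relative to an ideal `K` of `C`: the elements that are
annihilated by some `r ∈ C` with `r ∉ K`. For `K = 0` these are the elements annihilated by some
nonzero `r`. If `K` annihilates `N`, they are the `C ⧸ K`-torsion elements of the
`C ⧸ K`-module `N`. -/
def torsionModulo {C : Type*} [CommRing C] (K : Ideal C) (N : Type*) [AddCommGroup N]
    [Module C N] : Set N :=
  {x | ∃ r : C, r ∉ K ∧ r • x = 0}

end BaxterAlgebra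

namespace BaxterAlgebra

universe u v w

/-! Write `B` for the domain `A ⧸ I`. The quotient map induces a surjection of shuffle algebras from
`A` to `B` whose kernel is exactly the generated Baxter ideal (`ker_map_mk`), so the question is
when `Sha C lam B` is a domain.

Necessity. If `r` is nonzero in `B`, then `r • 1` is nonzero in `Sha C lam B`, so in a domain it
kills no nonzero tensor. For the characteristic, let `e n` be the tensor of `n + 1` ones. Then `e 1
* e n` is `(n + 1) * e (n + 1)` plus a scalar multiple of `e n`, hence `(n + 1)! * e (n + 1)` is the
product of `n! * e n` and some `e 1 - r • 1`. The latter never vanishes, so no `n!` does.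

Sufficiency. Only the top components of two nonzero factors matter, and in the top degree of the
product only the shuffles without merging survive, so the weight plays no role. Let `L` be the
fraction field of `B` and `K` the subfield generated by the image of `C`. A `K`-basis of the span of
`B`, chosen inside `B`, has coordinate functionals (`exists_dual_family`). Apply the inclusion into
`L` to the leading factor of a tensor and coordinate functionals to the others: this gives a
coefficient in `L` for every word in the basis. After denominators are cleared, torsion-freeness
shows that a nonzero tensor has a nonzero coefficient, and it has only finitely many, so there is a
lexicographically largest word (`exists_isLeadingWord`). Among all shuffles of the leading words `u`
and `v` of the factors take the largest word `w`. Its coefficient in the product is a positive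
integer, the number of shuffles that produce `w`, times the product of the two leading coefficients
(`exists_coeff_mul_ne_zero`). In characteristic zero this is nonzero. -/

theorem push_apply_of_injective {ι κ A : Type*} [Fintype ι] [DecidableEq κ] [CommRing A]
    {F : ι → κ} (hF : Function.Injective F) (x : ι → A) (i : ι) : push F x (F i) = x i := by
  classical
  rw [push, Finset.prod_eq_single i]
  · exact fun i' hi' hne => absurd (hF (Finset.mem_filter.mp hi').2) hne
  · intro h
    simp at h

theorem push_apply_of_notMem_range {ι κ A : Type*} [Fintype ι] [DecidableEq κ] [CommRing A]
    {F : ι → κ} (x : ι → A) {j : κ} (hj : ∀ i, F i ≠ j) : push F x j = 1 := by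
  rw [push, Finset.filter_false_of_mem fun i _ => hj i, Finset.prod_empty]

theorem map_push {ι κ A B : Type*} [Fintype ι] [DecidableEq κ] [CommRing A] [CommRing B]
    (f : A →+* B) (F : ι → κ) (x : ι → A) : f ∘ push F x = push F (f ∘ x) := by
  funext j
  simp [push, map_prod]

/-! ### Position zero and stuffles with trivial left factor -/

namespace Stuffle

variable {m n : ℕ}

theorem F_eq_zero_iff (s : Stuffle m n) {i : Fin (m + 1)} : s.F i = 0 ↔ i = 0 := by
  rw [← s.F0, s.monoF.injective.eq_iff]

theorem G_eq_zero_iff (s : Stuffle m n) {i : Fin (n + 1)} : s.G i = 0 ↔ i = 0 := by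
  rw [← s.G0, s.monoG.injective.eq_iff]

/-- The only stuffle with trivial left factor. -/
def ofRight (n : ℕ) : Stuffle 0 n :=
  ⟨n, fun _ => 0, fun i => i, Subsingleton.strictMono (α := Fin 1) _, strictMono_id, rfl, rfl,
    fun j => Or.inr ⟨j, rfl⟩⟩

/-- The left map hits only `0`, which `G` hits as well, so `G` is an increasing bijection and hence
the identity. -/
theorem eq_ofRight (s : Stuffle 0 n) : s = ofRight n := by
  obtain ⟨k, F, G, mF, mG, F0, G0, sj⟩ := s
  have hF : ∀ i, F i = 0 := fun i => by rw [Subsingleton.elim (α := Fin 1) i 0, F0]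
  have hs : Function.Surjective G := fun j => by
    rcases sj j with ⟨i, rfl⟩ | h
    · exact ⟨0, by rw [hF, G0]⟩
    · exact h
  have hk := Fintype.card_of_bijective ⟨mG.injective, hs⟩
  simp only [Fintype.card_fin, Nat.add_right_cancel_iff] at hk
  subst hk
  obtain rfl : G = fun i => i := by
    refine (StrictMono.range_inj mG strictMono_id).mp ?_
    rw [hs.range_eq, Set.range_id]
  obtain rfl : F = fun _ => 0 := funext hF
  rfl

end Stuffle

/-! ### The quotient by the generated Baxter ideal -/

namespace Sha

variable {C : Type u} [CommRing C] {lam : C} {A : Type v} [CommRing A] [Algebra C A]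
  {B : Type w} [CommRing B] [Algebra C B]

/-- There is only one stuffle to sum over, `Stuffle.ofRight n`, and its weight exponent is zero. -/
theorem j_mul_pure (a : A) {n : ℕ} (x : Fin (n + 1) → A) :
    (j C lam a * pure C lam x : Sha C lam A) = pure C lam (Function.update x 0 (a * x 0)) := by
  have h : Function.update (1 : Fin (n + 1) → A) 0 a * x = Function.update x 0 (a * x 0) := by
    funext i
    rcases eq_or_ne i 0 with rfl | hi <;> simp_all
  have h1 : push (fun _ : Fin (0 + 1) => (0 : Fin (n + 1))) (fun _ => a) =
      Function.update (1 : Fin (n + 1) → A) 0 a := by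
    funext i
    rcases eq_or_ne i 0 with rfl | hi
    · rw [Function.update_self]
      exact push_apply_of_injective
        (Function.injective_of_subsingleton (α := Fin 1) _) (fun _ => a) (0 : Fin 1)
    · rw [Function.update_of_ne hi]
      exact push_apply_of_notMem_range _ fun _ => hi.symm
  rw [j, pure_mul_pure_stuffle,
    Fintype.sum_eq_single (Stuffle.ofRight n) fun s hs => absurd s.eq_ofRight hs]
  change lam ^ (0 + n - n) • pure C lam (k := n)
    (push (fun _ : Fin (0 + 1) => (0 : Fin (n + 1))) (fun _ => a) * push (fun i => i) x) = _
  rw [h1, push_id, h, zero_add, Nat.sub_self, pow_zero, one_smul]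

/-- Pure tensors arise from `A` by multiplication and the Baxter operator alone. This is what makes
induction on the degree work for Baxter ideals. -/
theorem pure_cons (a : A) {n : ℕ} (x : Fin (n + 1) → A) :
    pure C lam (k := n + 1) (Fin.cons a x) = j C lam a * P C lam A (pure C lam x) := by
  rw [P_pure, j_mul_pure]
  simp

theorem j_add (a b : A) : j C lam (a + b) = j C lam a + j C lam b := by
  have h : ∀ a : A, j C lam a = pure C lam (k := 0) (Function.update (fun _ => (0 : A)) 0 a) :=
    fun a => congrArg (pure C lam (k := 0)) (funext fun i => by
      rw [Subsingleton.elim (α := Fin 1) i 0, Function.update_self])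
  rw [h, h, h, pure, MultilinearMap.map_update_add, map_add]
  rfl

theorem j_sub (a b : A) : j C lam (a - b) = j C lam a - j C lam b := by
  rw [eq_sub_iff_add_eq, ← j_add, sub_add_cancel]

/-- The map of shuffle Baxter algebras induced by an algebra homomorphism, as a linear map. -/
noncomputable def mapLinear (lam : C) (f : A →ₐ[C] B) : Sha C lam A →ₗ[C] Sha C lam B :=
  ofComponents fun k => incl C lam B k ∘ₗ PiTensorProduct.map fun _ => f.toLinearMap

theorem mapLinear_pure (f : A →ₐ[C] B) {k : ℕ} (x : Fin (k + 1) → A) :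
    mapLinear lam f (pure C lam x) = pure C lam (f ∘ x) := by
  rw [mapLinear, pure, ofComponents_incl, LinearMap.comp_apply, PiTensorProduct.map_tprod]
  rfl

theorem mapLinear_mul (f : A →ₐ[C] B) (x y : Sha C lam A) :
    mapLinear lam f (x * y) = mapLinear lam f x * mapLinear lam f y := by
  induction x using Sha.induction with
  | hsmul c x hx => rw [Sha.smul_mul, map_smul, map_smul, Sha.smul_mul, hx]
  | hadd x x' hx hx' => rw [Sha.add_mul, map_add, map_add, Sha.add_mul, hx, hx']
  | hpure m x =>
    induction y using Sha.induction with
    | hsmul c y hy => rw [Sha.mul_smul, map_smul, map_smul, Sha.mul_smul, hy]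
    | hadd y y' hy hy' => rw [Sha.mul_add, map_add, map_add, Sha.mul_add, hy, hy']
    | hpure n y =>
      rw [mapLinear_pure, mapLinear_pure, pure_mul_pure_stuffle, pure_mul_pure_stuffle, map_sum]
      refine Finset.sum_congr rfl fun s _ => ?_
      rw [map_smul, mapLinear_pure]
      have h : f ∘ (push s.F x * push s.G y) = push s.F (f ∘ x) * push s.G (f ∘ y) := by
        have h1 := map_push f.toRingHom s.F x
        have h2 := map_push f.toRingHom s.G y
        change f ∘ push s.F x = push s.F (f ∘ x) at h1
        change f ∘ push s.G y = push s.G (f ∘ y) at h2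
        rw [← h1, ← h2]
        funext i
        simp
      rw [h]

/-- The ring homomorphism of shuffle Baxter algebras induced by an algebra homomorphism. -/
noncomputable def map (lam : C) (f : A →ₐ[C] B) : Sha C lam A →+* Sha C lam B where
  toFun := mapLinear lam f
  map_one' := by
    rw [one_def, mapLinear_pure, one_def]
    congr 1
    funext i
    simp
  map_mul' := mapLinear_mul f
  map_zero' := map_zero _
  map_add' := map_add _

theorem map_pure (f : A →ₐ[C] B) {k : ℕ} (x : Fin (k + 1) → A) :
    map lam f (pure C lam x) = pure C lam (f ∘ x) :=
  mapLinear_pure f x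

theorem map_smul' (f : A →ₐ[C] B) (c : C) (x : Sha C lam A) :
    map lam f (c • x) = c • map lam f x :=
  map_smul (mapLinear lam f) c x

theorem map_P (f : A →ₐ[C] B) (x : Sha C lam A) :
    map lam f (P C lam A x) = P C lam B (map lam f x) := by
  induction x using Sha.induction with
  | hsmul c x hx => rw [map_smul, map_smul', map_smul', map_smul, hx]
  | hadd x x' hx hx' => simp only [map_add, hx, hx']
  | hpure k x =>
    rw [P_pure, map_pure, map_pure, P_pure]
    congr 1
    funext i
    refine Fin.cases ?_ (fun i => ?_) i <;> simp

theorem map_surjective {f : A →ₐ[C] B} (hf : Function.Surjective f) :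
    Function.Surjective (map lam f) := by
  intro y
  induction y using Sha.induction with
  | hsmul c y hy =>
    obtain ⟨x, rfl⟩ := hy
    exact ⟨c • x, map_smul' f c x⟩
  | hadd y y' hy hy' =>
    obtain ⟨x, rfl⟩ := hy
    obtain ⟨x', rfl⟩ := hy'
    exact ⟨x + x', map_add _ _ _⟩
  | hpure k y =>
    choose x hx using fun i => hf (y i)
    exact ⟨pure C lam x, by rw [map_pure]; exact congrArg _ (funext hx)⟩

/-- By `pure_cons`, the difference splits into a multiple of `j C lam (x 0 - y 0)` and a multiple of
the Baxter operator applied to the difference of the tails; induction on the degree handles the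
latter. -/
theorem pure_sub_pure_mem {I : Ideal A} {J : Ideal (Sha C lam A)}
    (hJ : IsBaxterIdeal (P C lam A) J) (hIJ : j C lam '' (I : Set A) ⊆ J) {k : ℕ}
    (x y : Fin (k + 1) → A) (h : ∀ i, x i - y i ∈ I) : pure C lam x - pure C lam y ∈ J := by
  induction k with
  | zero =>
    have hj : ∀ z : Fin (0 + 1) → A, pure C lam z = j C lam (z 0) := fun z =>
      congrArg (pure C lam (k := 0)) (funext fun i => by rw [Subsingleton.elim (α := Fin 1) i 0])
    rw [hj, hj, ← j_sub]
    exact hIJ ⟨_, h 0, rfl⟩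
  | succ k ih =>
    rw [← Fin.cons_self_tail x, ← Fin.cons_self_tail y, pure_cons, pure_cons]
    have h1 : j C lam (x 0) * P C lam A (pure C lam (Fin.tail x)) -
        j C lam (y 0) * P C lam A (pure C lam (Fin.tail y)) =
        j C lam (x 0 - y 0) * P C lam A (pure C lam (Fin.tail x)) +
        j C lam (y 0) * P C lam A (pure C lam (Fin.tail x) - pure C lam (Fin.tail y)) := by
      rw [j_sub, map_sub]
      ring
    rw [h1]
    exact J.add_mem (J.mul_mem_right _ (hIJ ⟨_, h 0, rfl⟩))
      (J.mul_mem_left _ (hJ _ (ih _ _ fun i => h i.succ)))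

/-- The pure tensors of lifts, modulo a Baxter ideal, as a multilinear map. -/
noncomputable def liftPure {I : Ideal A} {J : Ideal (Sha C lam A)}
    (hJ : IsBaxterIdeal (P C lam A) J) (hIJ : j C lam '' (I : Set A) ⊆ J) (k : ℕ) :
    MultilinearMap C (fun _ : Fin (k + 1) => A ⧸ I) (Sha C lam A ⧸ J) where
  toFun x := Ideal.Quotient.mk J (pure C lam fun i => (x i).out)
  map_update_add' {_} x i a b := by
    obtain rfl : ‹DecidableEq (Fin (k + 1))› = instDecidableEqFin _ := Subsingleton.elim _ _
    -- The choice `out` of representatives is not additive, but modulo `J` any lift `c'` of the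
    -- updated entry gives the same class, so the sum of the chosen lifts may be used.
    have h : ∀ c : A ⧸ I, ∀ c' : A, Ideal.Quotient.mk I c' = c →
        Ideal.Quotient.mk J (pure C lam fun l => (Function.update x i c l).out) =
        Ideal.Quotient.mk J (pure C lam (Function.update (fun l => (x l).out) i c')) := by
      rintro _ c' rfl
      refine Ideal.Quotient.eq.mpr (pure_sub_pure_mem hJ hIJ _ _ fun l => ?_)
      rw [← Ideal.Quotient.eq]
      refine (Ideal.Quotient.mk_out _).trans ?_
      rcases eq_or_ne l i with rfl | hl
      · simp
      · simp [hl]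
    rw [h (a + b) (a.out + b.out) (by simp), h a a.out (by simp), h b b.out (by simp),
      ← map_add]
    simp only [pure, MultilinearMap.map_update_add, map_add]
  map_update_smul' {_} x i r a := by
    obtain rfl : ‹DecidableEq (Fin (k + 1))› = instDecidableEqFin _ := Subsingleton.elim _ _
    have h : ∀ c : A ⧸ I, ∀ c' : A, Ideal.Quotient.mk I c' = c →
        Ideal.Quotient.mk J (pure C lam fun l => (Function.update x i c l).out) =
        Ideal.Quotient.mk J (pure C lam (Function.update (fun l => (x l).out) i c')) := by
      rintro _ c' rfl
      refine Ideal.Quotient.eq.mpr (pure_sub_pure_mem hJ hIJ _ _ fun l => ?_)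
      rw [← Ideal.Quotient.eq]
      refine (Ideal.Quotient.mk_out _).trans ?_
      rcases eq_or_ne l i with rfl | hl
      · simp
      · simp [hl]
    rw [h (r • a) (r • a.out) (by
      rw [← Ideal.Quotient.mkₐ_eq_mk C, map_smul, Ideal.Quotient.mkₐ_eq_mk,
        Ideal.Quotient.mk_out]), h a a.out (by simp)]
    simp only [pure, MultilinearMap.map_update_smul, map_smul]
    rfl

/-- The kernel is a Baxter ideal that contains the image of `I`, so it contains the smallest one.
Conversely, sending pure tensors to their lifts defines a map `g` through which the projection
modulo `J` factors, so the kernel lies in `J`. -/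
theorem ker_map_mk (lam : C) (I : Ideal A) :
    RingHom.ker (map lam (Ideal.Quotient.mkₐ C I)) =
      baxterIdealSpan (P C lam A) (j C lam '' (I : Set A)) := by
  set J := baxterIdealSpan (P C lam A) (j C lam '' (I : Set A)) with hJdef
  have hJ : IsBaxterIdeal (P C lam A) J := isBaxterIdeal_baxterIdealSpan _ _
  have hIJ : j C lam '' (I : Set A) ⊆ J := subset_baxterIdealSpan _ _
  refine le_antisymm (fun z hz => ?_) (sInf_le ⟨fun x hx => ?_, ?_⟩)
  · let g : Sha C lam (A ⧸ I) →ₗ[C] Sha C lam A ⧸ J :=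
      ofComponents fun k => PiTensorProduct.lift (liftPure hJ hIJ k)
    have hg : ∀ x : Sha C lam A,
        g (map lam (Ideal.Quotient.mkₐ C I) x) = Ideal.Quotient.mkₐ C J x := by
      intro x
      induction x using Sha.induction with
      | hsmul c x hx => rw [map_smul', map_smul, map_smul, hx]
      | hadd x x' hx hx' => rw [map_add, map_add, map_add, hx, hx']
      | hpure k x =>
        rw [map_pure]
        change ofComponents _ (incl C lam _ k _) = _
        rw [ofComponents_incl, PiTensorProduct.lift.tprod]
        refine Ideal.Quotient.eq.mpr (pure_sub_pure_mem hJ hIJ _ _ fun i => ?_)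
        rw [← Ideal.Quotient.eq]
        exact Ideal.Quotient.mk_out _
    have h := hg z
    rw [RingHom.mem_ker.mp hz, map_zero] at h
    exact Ideal.Quotient.eq_zero_iff_mem.mp h.symm
  · rw [RingHom.mem_ker, map_P, RingHom.mem_ker.mp hx, map_zero]
  · rintro _ ⟨a, ha, rfl⟩
    rw [SetLike.mem_coe, RingHom.mem_ker, j, map_pure]
    have h : (Ideal.Quotient.mkₐ C I ∘ fun _ : Fin (0 + 1) => a) = 0 :=
      funext fun _ => Ideal.Quotient.eq_zero_iff_mem.mpr ha
    rw [h, pure, MultilinearMap.map_zero, map_zero]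

theorem isPrime_baxterIdealSpan_iff (lam : C) (I : Ideal A) :
    (baxterIdealSpan (P C lam A) (j C lam '' (I : Set A))).IsPrime ↔
      IsDomain (Sha C lam (A ⧸ I)) := by
  rw [← ker_map_mk, ← Ideal.Quotient.isDomain_iff_prime]
  exact (RingHom.quotientKerEquivOfSurjective
    (map_surjective (lam := lam) (Ideal.Quotient.mkₐ_surjective C I))).toMulEquiv.isDomain_iff

end Sha

/-! ### Shuffles without merging -/

namespace Stuffle

variable {m n : ℕ}

theorem F_succ_ne_zero (s : Stuffle m n) (i : Fin m) : s.F i.succ ≠ 0 :=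
  s.F_eq_zero_iff.not.mpr (Fin.succ_ne_zero i)

theorem G_succ_ne_zero (s : Stuffle m n) (i : Fin n) : s.G i.succ ≠ 0 :=
  s.G_eq_zero_iff.not.mpr (Fin.succ_ne_zero i)

/-- The position in the last `k` factors of a factor of `x` or of `y`. -/
def position (s : Stuffle m n) : Fin m ⊕ Fin n → Fin s.k :=
  Sum.elim (fun i => (s.F i.succ).pred (s.F_succ_ne_zero i))
    fun i => (s.G i.succ).pred (s.G_succ_ne_zero i)

theorem succ_position_inl (s : Stuffle m n) (i : Fin m) :
    (s.position (Sum.inl i)).succ = s.F i.succ :=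
  Fin.succ_pred _ (s.F_succ_ne_zero i)

theorem succ_position_inr (s : Stuffle m n) (i : Fin n) :
    (s.position (Sum.inr i)).succ = s.G i.succ :=
  Fin.succ_pred _ (s.G_succ_ne_zero i)

theorem position_surjective (s : Stuffle m n) : Function.Surjective s.position := by
  intro q
  rcases s.surj q.succ with ⟨i, hi⟩ | ⟨i, hi⟩
  · obtain ⟨i, rfl⟩ := Fin.exists_succ_eq.mpr (s.F_eq_zero_iff.not.mp
      (hi ▸ Fin.succ_ne_zero q))
    exact ⟨Sum.inl i, Fin.succ_injective _ (by rw [succ_position_inl, hi])⟩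
  · obtain ⟨i, rfl⟩ := Fin.exists_succ_eq.mpr (s.G_eq_zero_iff.not.mp
      (hi ▸ Fin.succ_ne_zero q))
    exact ⟨Sum.inr i, Fin.succ_injective _ (by rw [succ_position_inr, hi])⟩

/-- The condition `s.k = m + n` expresses that no two letters are merged: a surjection between
finite sets of equal size is injective. -/
theorem position_bijective (s : Stuffle m n) (hk : s.k = m + n) :
    Function.Bijective s.position :=
  (Fintype.bijective_iff_surjective_and_card _).mpr ⟨s.position_surjective, by simp [hk]⟩

theorem F_succ_ne_G_succ (s : Stuffle m n) (hk : s.k = m + n) (i : Fin m) (i' : Fin n) :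
    s.F i.succ ≠ s.G i'.succ := by
  rw [← succ_position_inl, ← succ_position_inr]
  exact fun h => Sum.inl_ne_inr ((s.position_bijective hk).1 (Fin.succ_injective _ h))

/-- Each position other than `0` holds exactly one letter of `x` or of `y`. Position `0` holds `x 0
* y 0`, which is why `f 0` has to be multiplicative. -/
theorem prod_push {A L : Type*} [CommRing A] [CommMonoid L] (s : Stuffle m n) (hk : s.k = m + n)
    (f : Fin (s.k + 1) → A → L) (h0 : ∀ a b, f 0 (a * b) = f 0 a * f 0 b)
    (x : Fin (m + 1) → A) (y : Fin (n + 1) → A) :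
    ∏ i, f i ((push s.F x * push s.G y) i) =
      (∏ i, f (s.F i) (x i)) * ∏ i, f (s.G i) (y i) := by
  have hF := push_apply_of_injective s.monoF.injective x
  have hG := push_apply_of_injective s.monoG.injective y
  have hF0 := hF 0
  have hG0 := hG 0
  rw [s.F0] at hF0
  rw [s.G0] at hG0
  have hl : ∀ i : Fin m, (push s.F x * push s.G y) (s.F i.succ) = x i.succ := fun i => by
    rw [Pi.mul_apply, hF, push_apply_of_notMem_range, mul_one]
    intro i'
    refine Fin.cases ?_ (fun i' => ?_) i'
    · rw [s.G0]
      exact (s.F_succ_ne_zero i).symm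
    · exact (s.F_succ_ne_G_succ hk i i').symm
  have hr : ∀ i : Fin n, (push s.F x * push s.G y) (s.G i.succ) = y i.succ := fun i => by
    rw [Pi.mul_apply, hG, push_apply_of_notMem_range, one_mul]
    intro i'
    refine Fin.cases ?_ (fun i' => ?_) i'
    · rw [s.F0]
      exact (s.G_succ_ne_zero i).symm
    · exact s.F_succ_ne_G_succ hk i' i
  rw [Fin.prod_univ_succ, Fin.prod_univ_succ (fun i => f (s.F i) (x i)),
    Fin.prod_univ_succ (fun i => f (s.G i) (y i)), ← (s.position_bijective hk).prod_comp,
    Fintype.prod_sum_type, s.F0, s.G0, Pi.mul_apply, hF0, hG0, h0, mul_mul_mul_comm]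
  simp only [succ_position_inl, succ_position_inr, hl, hr]

/-- The word with the letters `u` in the positions `s.F` and `v` in the positions `s.G`, followed by
the letter `o`. -/
noncomputable def merge {κ : Type*} (s : Stuffle m n) (o : κ) (u : Fin (m + 1) → κ)
    (v : Fin (n + 1) → κ) (l : ℕ) : κ :=
  open Classical in
  if h : ∃ i, (s.F i : ℕ) = l then u h.choose
  else if h : ∃ i, (s.G i : ℕ) = l then v h.choose else o

theorem merge_F {κ : Type*} (s : Stuffle m n) (o : κ) (u : Fin (m + 1) → κ)
    (v : Fin (n + 1) → κ) (i : Fin (m + 1)) : s.merge o u v (s.F i) = u i := by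
  have h : ∃ i', (s.F i' : ℕ) = s.F i := ⟨i, rfl⟩
  rw [merge, dif_pos h, s.monoF.injective (Fin.ext h.choose_spec)]

/-- The definition gives precedence to `u`. The two maps meet only at position `0`, where `huv`
removes the conflict. -/
theorem merge_G {κ : Type*} (s : Stuffle m n) (hk : s.k = m + n) (o : κ) {u : Fin (m + 1) → κ}
    {v : Fin (n + 1) → κ} (huv : u 0 = v 0) (i : Fin (n + 1)) : s.merge o u v (s.G i) = v i := by
  induction i using Fin.cases with
  | zero => rw [s.G0, ← huv, ← s.merge_F o u v 0, s.F0]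
  | succ i =>
    have h : ∃ i', (s.G i' : ℕ) = s.G i.succ := ⟨i.succ, rfl⟩
    have h' : ¬ ∃ i', (s.F i' : ℕ) = s.G i.succ := by
      rintro ⟨i', hi'⟩
      have hi' := Fin.ext hi'
      induction i' using Fin.cases with
      | zero => exact s.G_succ_ne_zero i (hi'.symm.trans s.F0)
      | succ i' => exact s.F_succ_ne_G_succ hk i' i hi'
    rw [merge, dif_neg h', dif_pos h, s.monoG.injective (Fin.ext h.choose_spec)]

/-- Merged words are functions on `ℕ`, so that those of different stuffles have one type and can be
compared. The constant tail ensures that the comparison is decided within the first `s.k + 1`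
letters. -/
theorem merge_of_lt {κ : Type*} (s : Stuffle m n) (o : κ) (u : Fin (m + 1) → κ)
    (v : Fin (n + 1) → κ) {l : ℕ} (hl : s.k < l) : s.merge o u v l = o := by
  rw [merge, dif_neg, dif_neg]
  · rintro ⟨i, rfl⟩
    have := (s.G i).isLt
    omega
  · rintro ⟨i, rfl⟩
    have := (s.F i).isLt
    omega

/-- Concatenation. -/
def concat (m n : ℕ) : Stuffle m n where
  k := m + n
  F i := ⟨i, by omega⟩
  G := Fin.cons 0 fun i => ⟨m + i + 1, by omega⟩
  monoF a b h := h
  monoG a b h := by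
    induction b using Fin.cases with
    | zero => exact absurd h (Fin.not_lt_zero _)
    | succ b =>
      induction a using Fin.cases with
      | zero => simp [Fin.lt_def]
      | succ a =>
        have h := Fin.lt_def.mp (Fin.succ_lt_succ_iff.mp h)
        simp only [Fin.cons_succ, Fin.lt_def]
        omega
  F0 := rfl
  G0 := rfl
  surj l := by
    by_cases h : (l : ℕ) < m + 1
    · exact Or.inl ⟨⟨l, h⟩, rfl⟩
    · refine Or.inr ⟨Fin.succ ⟨l - m - 1, by omega⟩, Fin.ext ?_⟩
      simp only [Fin.cons_succ]
      omega

end Stuffle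

/-! ### Coefficients of products in the top degree -/

/-- The linear functional `x₀ ⊗ … ⊗ xₘ ↦ ∏ c (u i) (x i)` of a family `c` of functionals and a word
`u`. -/
noncomputable def wordFunctional {C A L κ : Type*} [CommRing C] [CommRing A] [Algebra C A]
    [CommRing L] [Algebra C L] (c : κ → A →ₗ[C] L) {m : ℕ} (u : Fin m → κ) : (⨂[C]^m A) →ₗ[C] L :=
  PiTensorProduct.lift
    ((MultilinearMap.mkPiAlgebra C (Fin m) L).compLinearMap fun i => c (u i))

theorem wordFunctional_tprod {C A L κ : Type*} [CommRing C] [CommRing A] [Algebra C A]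
    [CommRing L] [Algebra C L] (c : κ → A →ₗ[C] L) {m : ℕ} (u : Fin m → κ) (x : Fin m → A) :
    wordFunctional c u (PiTensorProduct.tprod C x) = ∏ i, c (u i) (x i) := by
  simp [wordFunctional]

namespace Sha

variable {C : Type u} [CommRing C] {lam : C} {A : Type v} [CommRing A] [Algebra C A]
  {L : Type*} [CommRing L] [Algebra C L] {κ : Type*}

/-- The functional on the shuffle Baxter algebra that is the functional of the first `N + 1` letters
of `w` on `A^{⊗ (N + 1)}` and zero on the other summands. -/
noncomputable def coeff (lam : C) (c : κ → A →ₗ[C] L) (N : ℕ) (w : ℕ → κ) : Sha C lam A →ₗ[C] L :=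
  ofComponents fun k => if k = N then wordFunctional c fun i => w i else 0

theorem coeff_incl (c : κ → A →ₗ[C] L) (N : ℕ) (w : ℕ → κ) (a : ⨂[C]^(N + 1) A) :
    coeff lam c N w (incl C lam A N a) = wordFunctional c (fun i => w i) a := by
  rw [coeff, ofComponents_incl, if_pos rfl]

theorem coeff_incl_of_ne (c : κ → A →ₗ[C] L) {N k : ℕ} (h : k ≠ N) (w : ℕ → κ)
    (a : ⨂[C]^(k + 1) A) : coeff lam c N w (incl C lam A k a) = 0 := by
  rw [coeff, ofComponents_incl, if_neg h, LinearMap.zero_apply]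

theorem coeff_pure (c : κ → A →ₗ[C] L) (N : ℕ) (w : ℕ → κ) (x : Fin (N + 1) → A) :
    coeff lam c N w (pure C lam x) = ∏ i : Fin (N + 1), c (w i) (x i) := by
  rw [pure, coeff_incl, wordFunctional_tprod]

theorem coeff_mul_of_lt (c : κ → A →ₗ[C] L) {N i k : ℕ} (h : i + k < N) (w : ℕ → κ)
    (a : ⨂[C]^(i + 1) A) (b : ⨂[C]^(k + 1) A) :
    coeff lam c N w (incl C lam A i a * incl C lam A k b) = 0 := by
  induction a using PiTensorProduct.induction_on with
  | add a a' ha ha' => rw [map_add, add_mul, map_add, ha, ha', add_zero]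
  | smul_tprod r x =>
    induction b using PiTensorProduct.induction_on with
    | add b b' hb hb' => rw [map_add, mul_add, map_add, hb, hb', add_zero]
    | smul_tprod r' y =>
      rw [map_smul, map_smul, Sha.smul_mul, Sha.mul_smul, map_smul, map_smul]
      change r • r' • coeff lam c N w (pure C lam x * pure C lam y) = 0
      rw [pure_mul_pure_stuffle, map_sum, Finset.sum_eq_zero, smul_zero, smul_zero]
      intro s _
      rw [map_smul, pure, coeff_incl_of_ne _ (by have := s.k_le; omega), smul_zero]

/-- Stuffles that merge letters land in lower degrees, and the others carry the exponent `0` of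
`lam`. Multiplicativity of `c (w 0)` splits the leading factor of the product. -/
theorem coeff_mul (c : κ → A →ₗ[C] L) {m n : ℕ} (w : ℕ → κ)
    (h0 : ∀ a b, c (w 0) (a * b) = c (w 0) a * c (w 0) b)
    (a : ⨂[C]^(m + 1) A) (b : ⨂[C]^(n + 1) A) :
    coeff lam c (m + n) w (incl C lam A m a * incl C lam A n b) =
      ∑ s : Stuffle m n with s.k = m + n,
        wordFunctional c (fun i => w (s.F i)) a * wordFunctional c (fun i => w (s.G i)) b := by
  induction a using PiTensorProduct.induction_on with
  | add a a' ha ha' =>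
    simp only [map_add, add_mul, ha, ha', Finset.sum_add_distrib]
  | smul_tprod r x =>
    induction b using PiTensorProduct.induction_on with
    | add b b' hb hb' => simp only [map_add, mul_add, hb, hb', Finset.sum_add_distrib]
    | smul_tprod r' y =>
      simp only [map_smul, smul_mul_assoc, mul_smul_comm,
        ← Finset.smul_sum]
      congr 2
      change coeff lam c _ w (pure C lam x * pure C lam y) = _
      rw [pure_mul_pure_stuffle, map_sum, Finset.sum_filter]
      refine Finset.sum_congr rfl fun s _ => ?_
      split_ifs with hk
      · rw [show m + n - s.k = 0 by omega, pow_zero, one_smul, ← hk, coeff_pure,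
          s.prod_push hk (fun i => c (w i)) h0, wordFunctional_tprod, wordFunctional_tprod]
      · rw [map_smul, pure, coeff_incl_of_ne _ hk, smul_zero]

end Sha

/-! ### Leading words -/

/-- A word whose first letter, and no other, is `o`. -/
def IsWord {κ : Type*} (o : κ) {m : ℕ} (u : Fin (m + 1) → κ) : Prop :=
  ∀ i, u i = o ↔ i = 0

/-- The word `u` is the largest one, in the lexicographic order, whose functional does not vanish at
`a`. -/
def IsLeadingWord {C A L κ : Type*} [CommRing C] [CommRing A] [Algebra C A] [CommRing L]
    [Algebra C L] [LinearOrder κ] (c : κ → A →ₗ[C] L) (o : κ) {m : ℕ} (a : ⨂[C]^(m + 1) A)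
    (u : Fin (m + 1) → κ) : Prop :=
  IsWord o u ∧ wordFunctional c u a ≠ 0 ∧
    ∀ u', IsWord o u' → wordFunctional c u' a ≠ 0 → toLex u' ≤ toLex u

namespace Stuffle

variable {m n : ℕ} {κ : Type*}

theorem merge_eq_iff (s : Stuffle m n) (hk : s.k = m + n) {o : κ} {u : Fin (m + 1) → κ}
    {v : Fin (n + 1) → κ} (hu : IsWord o u) (hv : IsWord o v) {l : ℕ} (hl : l ≤ m + n) :
    s.merge o u v l = o ↔ l = 0 := by
  have huv : u 0 = v 0 := ((hu 0).mpr rfl).trans ((hv 0).mpr rfl).symm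
  obtain ⟨l', rfl⟩ : ∃ l' : Fin (s.k + 1), (l' : ℕ) = l := ⟨⟨l, by omega⟩, rfl⟩
  rw [Fin.val_eq_zero_iff]
  rcases s.surj l' with ⟨i, rfl⟩ | ⟨i, rfl⟩
  · rw [merge_F, hu, s.F_eq_zero_iff]
  · rw [s.merge_G hk o huv, hv, s.G_eq_zero_iff]

/-- The first position where `w` exceeds the merged word belongs to `u` or to `v`. As the maps are
increasing, the restriction of `w` to the positions of that factor then first differs from it at the
corresponding letter and is larger, against `hu` or `hv`. -/
theorem not_lex_merge_lt [LinearOrder κ] (s : Stuffle m n) (hk : s.k = m + n) {o : κ}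
    {u : Fin (m + 1) → κ} {v : Fin (n + 1) → κ} (huv : u 0 = v 0) {w : ℕ → κ}
    (hw : ∀ l, m + n < l → w l = o)
    (hu : toLex (fun i => w (s.F i)) ≤ toLex u) (hv : toLex (fun i => w (s.G i)) ≤ toLex v) :
    ¬ toLex (s.merge o u v) < toLex w := by
  rintro ⟨l, hl, hlt⟩
  simp only [Pi.toLex_apply] at hl hlt
  have hle : l ≤ m + n := by
    by_contra hle
    rw [s.merge_of_lt o u v (by omega), hw l (by omega)] at hlt
    exact lt_irrefl _ hlt
  obtain ⟨l', rfl⟩ : ∃ l' : Fin (s.k + 1), (l' : ℕ) = l := ⟨⟨l, by omega⟩, rfl⟩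
  rcases s.surj l' with ⟨i, rfl⟩ | ⟨i, rfl⟩
  · refine hu.not_gt ⟨i, fun i' hi' => ?_, ?_⟩
    · have := hl (s.F i') (Fin.lt_def.mp (s.monoF hi'))
      rwa [merge_F] at this
    · rwa [merge_F] at hlt
  · refine hv.not_gt ⟨i, fun i' hi' => ?_, ?_⟩
    · have := hl (s.G i') (Fin.lt_def.mp (s.monoG hi'))
      rwa [s.merge_G hk o huv] at this
    · rwa [s.merge_G hk o huv] at hlt

end Stuffle

namespace Sha

variable {C : Type u} [CommRing C] {lam : C} {A : Type v} [CommRing A] [Algebra C A]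
  {L : Type*} [CommRing L] [Algebra C L] {κ : Type*}

/-- The word `w` is the largest merge of `u` and `v`. Every shuffle that contributes to its
coefficient yields `w` itself and contributes the same nonzero amount, so nothing can cancel in
characteristic zero. -/
theorem exists_coeff_mul_ne_zero [IsDomain L] [CharZero L] [LinearOrder κ] {c : κ → A →ₗ[C] L}
    {o : κ} (h0 : ∀ a b, c o (a * b) = c o a * c o b) {m n : ℕ} {a : ⨂[C]^(m + 1) A}
    {b : ⨂[C]^(n + 1) A} {u : Fin (m + 1) → κ} {v : Fin (n + 1) → κ}
    (hu : IsLeadingWord c o a u) (hv : IsLeadingWord c o b v) :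
    ∃ w : ℕ → κ, coeff lam c (m + n) w (incl C lam A m a * incl C lam A n b) ≠ 0 := by
  classical
  obtain ⟨hu, hua, hul⟩ := hu
  obtain ⟨hv, hvb, hvl⟩ := hv
  have huv : u 0 = v 0 := ((hu 0).mpr rfl).trans ((hv 0).mpr rfl).symm
  obtain ⟨s₀, hs₀, hmax⟩ := Finset.exists_max_image
    (Finset.univ.filter fun s : Stuffle m n => s.k = m + n) (fun s => toLex (s.merge o u v))
    ⟨Stuffle.concat m n, Finset.mem_filter.mpr ⟨Finset.mem_univ _, rfl⟩⟩
  have hk₀ := (Finset.mem_filter.mp hs₀).2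
  set w := s₀.merge o u v with hw
  have hw0 : ∀ {l}, l ≤ m + n → (w l = o ↔ l = 0) := s₀.merge_eq_iff hk₀ hu hv
  have key : ∀ s ∈ Finset.univ.filter (fun s : Stuffle m n => s.k = m + n),
      wordFunctional c (fun i => w (s.F i)) a * wordFunctional c (fun i => w (s.G i)) b =
        if s.merge o u v = w then wordFunctional c u a * wordFunctional c v b else 0 := by
    intro s hs
    have hk := (Finset.mem_filter.mp hs).2
    split_ifs with h
    · have h1 : (fun i => w (s.F i)) = u := funext fun i => by rw [← h, s.merge_F]
      have h2 : (fun i => w (s.G i)) = v := funext fun i => by rw [← h, s.merge_G hk o huv]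
      rw [h1, h2]
    -- For a nonzero term, both restrictions of `w` are words with nonzero functional, hence at most
    -- `u` and `v`. The merge along `s` is then not below `w`, although maximality and `h` put it
    -- there.
    · by_contra hne
      have h1 : IsWord o fun i => w (s.F i) := fun i => by
        rw [hw0 (by have := (s.F i).isLt; omega), Fin.val_eq_zero_iff, s.F_eq_zero_iff]
      have h2 : IsWord o fun i => w (s.G i) := fun i => by
        rw [hw0 (by have := (s.G i).isLt; omega), Fin.val_eq_zero_iff, s.G_eq_zero_iff]
      have hlt : toLex (s.merge o u v) < toLex w :=
        lt_of_le_of_ne (hmax s hs) fun h' => h (toLex_inj.mp h')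
      exact s.not_lex_merge_lt hk huv (w := w) (fun l hl => s₀.merge_of_lt o u v (by omega))
        (hul _ h1 (left_ne_zero_of_mul hne)) (hvl _ h2 (right_ne_zero_of_mul hne)) hlt
  refine ⟨w, ?_⟩
  rw [coeff_mul c w (by rwa [(hw0 (Nat.zero_le _)).mpr rfl]), Finset.sum_congr rfl key,
    ← Finset.sum_filter, Finset.sum_const, nsmul_eq_mul]
  refine mul_ne_zero (Nat.cast_ne_zero.mpr (Finset.card_ne_zero.mpr ⟨s₀, ?_⟩))
    (mul_ne_zero hua hvb)
  exact Finset.mem_filter.mpr ⟨hs₀, rfl⟩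

theorem exists_eq_sum_incl {x : Sha C lam A} (hx : x ≠ 0) :
    ∃ (m : ℕ) (a : ∀ k, ⨂[C]^(k + 1) A), a m ≠ 0 ∧
      x = ∑ k ∈ Finset.range (m + 1), incl C lam A k (a k) := by
  classical
  let x' : ⨁ k : ℕ, ⨂[C]^(k + 1) A := x
  have hne : (DFinsupp.support x').Nonempty := by
    rw [Finset.nonempty_iff_ne_empty, ne_eq, DFinsupp.support_eq_empty]
    exact hx
  refine ⟨_, fun k => x' k, DFinsupp.mem_support_iff.mp (Finset.max'_mem _ hne), ?_⟩
  refine (DirectSum.sum_support_of x').symm.trans (Finset.sum_subset (fun k hk => ?_)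
    fun k _ hk => ?_)
  · exact Finset.mem_range_succ_iff.mpr (Finset.le_max' _ _ hk)
  · rw [DFinsupp.notMem_support_iff.mp hk, map_zero]

/-- A product of components of degrees `i` and `k` has no component above `i + k`, so only the two
top components reach degree `m + n`. -/
theorem coeff_sum_mul_sum (c : κ → A →ₗ[C] L) (w : ℕ → κ) (m n : ℕ)
    (a b : ∀ k, ⨂[C]^(k + 1) A) :
    coeff lam c (m + n) w ((∑ k ∈ Finset.range (m + 1), incl C lam A k (a k)) *
        ∑ k ∈ Finset.range (n + 1), incl C lam A k (b k)) =
      coeff lam c (m + n) w (incl C lam A m (a m) * incl C lam A n (b n)) := by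
  rw [Finset.sum_mul_sum, map_sum, Finset.sum_eq_single m, map_sum, Finset.sum_eq_single n]
  · intro k hk hkn
    have := Finset.mem_range_succ_iff.mp hk
    exact coeff_mul_of_lt c (by omega) w _ _
  · simp
  · intro i hi him
    have := Finset.mem_range_succ_iff.mp hi
    rw [map_sum]
    refine Finset.sum_eq_zero fun k hk => ?_
    have := Finset.mem_range_succ_iff.mp hk
    exact coeff_mul_of_lt c (by omega) w _ _
  · simp

theorem noZeroDivisors_of_exists_isLeadingWord [IsDomain L] [CharZero L] [LinearOrder κ]
    {c : κ → A →ₗ[C] L} {o : κ} (h0 : ∀ a b, c o (a * b) = c o a * c o b)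
    (h : ∀ (m : ℕ) (a : ⨂[C]^(m + 1) A), a ≠ 0 → ∃ u, IsLeadingWord c o a u) :
    NoZeroDivisors (Sha C lam A) where
  eq_zero_or_eq_zero_of_mul_eq_zero {x y} hxy := by
    by_contra! hne
    obtain ⟨m, a, ha, rfl⟩ := exists_eq_sum_incl hne.1
    obtain ⟨n, b, hb, rfl⟩ := exists_eq_sum_incl hne.2
    obtain ⟨u, hu⟩ := h m _ ha
    obtain ⟨v, hv⟩ := h n _ hb
    obtain ⟨w, hw⟩ := exists_coeff_mul_ne_zero (lam := lam) h0 hu hv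
    rw [← coeff_sum_mul_sum c w m n a b, hxy, map_zero] at hw
    exact hw rfl

theorem nontrivial [Nontrivial A] : Nontrivial (Sha C lam A) := by
  refine ⟨⟨1, 0, fun h => ?_⟩⟩
  -- With a one-letter alphabet whose functional is the identity, `coeff` in degree `0` is the
  -- projection to `A`.
  have h1 := congrArg (coeff lam (fun _ : Unit => LinearMap.id (R := C) (M := A)) 0 fun _ => ()) h
  rw [one_def, coeff_pure, map_zero] at h1
  simp at h1

end Sha

/-! ### Dual families up to denominators -/

theorem exists_mul_eq_of_mem_closure_range {C L : Type*} [CommRing C] [Field L] [Algebra C L]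
    {k : L} (hk : k ∈ Subfield.closure (Set.range (algebraMap C L))) :
    ∃ p q : C, algebraMap C L q ≠ 0 ∧ algebraMap C L q * k = algebraMap C L p := by
  have hcl : Subring.closure (Set.range (algebraMap C L)) = (algebraMap C L).range := by
    rw [← RingHom.coe_range, Subring.closure_eq]
  rw [Subfield.mem_closure_iff, hcl] at hk
  obtain ⟨_, ⟨p, rfl⟩, _, ⟨q, rfl⟩, rfl⟩ := hk
  -- Division by zero gives zero in `L`, so in this case the element equals `0 / 1`.
  by_cases hq : algebraMap C L q = 0
  · exact ⟨0, 1, by simp, by simp [hq]⟩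
  · exact ⟨p, q, hq, mul_div_cancel₀ _ hq⟩

theorem exists_smul_mem_span {C L ι : Type*} [CommRing C] [Field L] [Algebra C L] (e : ι → L)
    {x : L} (hx : x ∈ Submodule.span (Subfield.closure (Set.range (algebraMap C L))) (Set.range e)) :
    ∃ r : C, algebraMap C L r ≠ 0 ∧ r • x ∈ Submodule.span C (Set.range e) := by
  induction hx using Submodule.span_induction with
  | mem x hx => exact ⟨1, by simp, by simpa using Submodule.subset_span hx⟩
  | zero => exact ⟨1, by simp, by simp⟩
  | add x y _ _ hx hy =>
    obtain ⟨r, hr, hx⟩ := hx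
    obtain ⟨s, hs, hy⟩ := hy
    refine ⟨r * s, by simp [hr, hs], ?_⟩
    rw [smul_add]
    refine add_mem ?_ ?_
    · rw [mul_comm, mul_smul]
      exact Submodule.smul_mem _ _ hx
    · rw [mul_smul]
      exact Submodule.smul_mem _ _ hy
  | smul k x _ hx =>
    obtain ⟨r, hr, hx⟩ := hx
    obtain ⟨p, q, hq, hk⟩ := exists_mul_eq_of_mem_closure_range k.2
    refine ⟨q * r, by simp [hr, hq], ?_⟩
    have h : (q * r) • k • x = p • r • x := by
      rw [Subfield.smul_def, smul_eq_mul]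
      simp only [Algebra.smul_def, ← hk, map_mul]
      ring
    rw [h]
    exact Submodule.smul_mem _ _ hx

/-- A subalgebra of a field has a family of elements with a dual family of functionals that spans it
up to denominators. -/
theorem exists_dual_family (C : Type*) {B : Type v} {L : Type*} [CommRing C] [CommRing B]
    [Algebra C B] [Field L] [Algebra B L] [Algebra C L] [IsScalarTower C B L]
    (hinj : Function.Injective (algebraMap B L)) :
    ∃ (ι : Type v) (e : ι → B) (c : ι → B →ₗ[C] L),
      (∀ i i', c i (e i') = open Classical in if i' = i then 1 else 0) ∧
      ∀ b, ∃ r : C, algebraMap C B r ≠ 0 ∧ r • b ∈ Submodule.span C (Set.range e) := by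
  classical
  -- Over the field `K` there is a basis of the span of `B`, and it can be chosen among the elements
  -- of `B`. The functionals are its coordinates, which are `C`-linear because the image of `C` lies
  -- in `K`.
  let K := Subfield.closure (Set.range (algebraMap C L))
  obtain ⟨ι, e, hspan, hli⟩ : ∃ (ι : Type v) (e : ι → B),
      Submodule.span K (Set.range fun i => algebraMap B L (e i)) =
        Submodule.span K (Set.range (algebraMap B L)) ∧
      LinearIndependent K fun i => algebraMap B L (e i) := by
    obtain ⟨ι, e, -, hspan, hli⟩ := exists_linearIndependent' K (algebraMap B L)
    exact ⟨ι, e, hspan, hli⟩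
  have hmem : ∀ b : B, algebraMap B L b ∈
      Submodule.span K (Set.range fun i => algebraMap B L (e i)) := by
    intro b
    rw [hspan]
    exact Submodule.subset_span ⟨b, rfl⟩
  refine ⟨ι, e, fun i => ⟨⟨fun b => (hli.repr ⟨_, hmem b⟩ i : K), fun a b => ?_⟩, fun r b => ?_⟩,
    fun i i' => ?_, fun b => ?_⟩
  · have h : (⟨_, hmem (a + b)⟩ : Submodule.span K (Set.range fun i => algebraMap B L (e i))) =
        ⟨_, hmem a⟩ + ⟨_, hmem b⟩ := Subtype.ext (map_add _ _ _)
    rw [h, map_add, Finsupp.add_apply]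
    rfl
  · let r' : K := ⟨algebraMap C L r, Subfield.subset_closure ⟨r, rfl⟩⟩
    have h : (⟨_, hmem (r • b)⟩ : Submodule.span K (Set.range fun i => algebraMap B L (e i))) =
        r' • ⟨_, hmem b⟩ := Subtype.ext (by
      change algebraMap B L (r • b) = algebraMap C L r * algebraMap B L b
      rw [Algebra.smul_def, map_mul, ← IsScalarTower.algebraMap_apply])
    change ((hli.repr ⟨_, hmem (r • b)⟩ i : K) : L) = r • ((hli.repr ⟨_, hmem b⟩ i : K) : L)
    rw [h, map_smul, Finsupp.smul_apply, Algebra.smul_def r]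
    rfl
  · change ((hli.repr ⟨_, hmem (e i')⟩ i : K) : L) = _
    rw [hli.repr_eq_single i' _ rfl, Finsupp.single_apply]
    split_ifs <;> simp
  -- Clearing denominators gives a `C`-linear relation in `L`, which injectivity of `B → L` carries
  -- back to `B`.
  · obtain ⟨r, hr, h⟩ := exists_smul_mem_span (C := C) _ (hmem b)
    refine ⟨r, fun h0 => hr ?_, ?_⟩
    · rw [IsScalarTower.algebraMap_apply C B L, h0, map_zero]
    · have h1 : (Set.range fun i => algebraMap B L (e i)) =
          (IsScalarTower.toAlgHom C B L).toLinearMap '' Set.range e := Set.range_comp _ _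
      have h2 : r • algebraMap B L b = (IsScalarTower.toAlgHom C B L).toLinearMap (r • b) :=
        (map_smul (IsScalarTower.toAlgHom C B L).toLinearMap r b).symm
      rw [h2, h1, Submodule.span_image] at h
      obtain ⟨b', hb', h3⟩ := h
      obtain rfl : b' = r • b := hinj h3
      exact hb'

theorem map_mem_of_mem_span_range {C M N ι κ : Type*} [CommRing C] [AddCommGroup M] [Module C M]
    [AddCommGroup N] [Module C N] [Fintype κ] (f : MultilinearMap C (fun _ : κ => M) N)
    (e : ι → M) (S : Submodule C N) (hf : ∀ w : κ → ι, f (e ∘ w) ∈ S) {y : κ → M}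
    (hy : ∀ i, y i ∈ Submodule.span C (Set.range e)) : f y ∈ S := by
  classical
  choose l hl using fun i => Finsupp.mem_span_range_iff_exists_finsupp.mp (hy i)
  have h : y = fun i => ∑ i' ∈ (l i).support, l i i' • e i' := funext fun i => (hl i).symm
  rw [h, f.map_sum_finset (fun i i' => l i i' • e i')]
  refine Submodule.sum_mem _ fun r _ => ?_
  rw [f.map_smul_univ (fun i => l i (r i)) fun i => e (r i)]
  exact S.smul_mem _ (hf r)

/-! ### Expansion of tensors in words -/

section Words

variable {C : Type u} [CommRing C] {B : Type v} [CommRing B] [Algebra C B] {ι : Type*}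

/-- The linear map that sends a family `f` to `∑ f w ⊗ e (w 0) ⊗ … ⊗ e (w (m - 1))`. -/
noncomputable def wordSum (C : Type u) [CommRing C] {B : Type v} [CommRing B] [Algebra C B]
    (e : ι → B) (m : ℕ) : ((Fin m → ι) →₀ B) →ₗ[C] ⨂[C]^(m + 1) B :=
  Finsupp.lsum C fun w =>
    (PiTensorProduct.tprod C : MultilinearMap C (fun _ : Fin (m + 1) => B) _).toLinearMap
      (Fin.cons 0 (e ∘ w)) 0

theorem wordSum_single (e : ι → B) {m : ℕ} (w : Fin m → ι) (b : B) :
    wordSum C e m (Finsupp.single w b) =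
      PiTensorProduct.tprod C (Fin.cons b (e ∘ w) : Fin (m + 1) → B) := by
  rw [wordSum, Finsupp.lsum_single, MultilinearMap.toLinearMap_apply, Fin.update_cons_zero]

/-- Only the last `m` factors are expanded in the family; the leading one stays arbitrary in `B`.
The denominators of the factors are multiplied, and their product stays nonzero because `B` is a
domain. -/
theorem exists_smul_mem_range_wordSum [IsDomain B] {e : ι → B}
    (he : ∀ b, ∃ r : C, algebraMap C B r ≠ 0 ∧ r • b ∈ Submodule.span C (Set.range e)) {m : ℕ}
    (z : ⨂[C]^(m + 1) B) :
    ∃ r : C, algebraMap C B r ≠ 0 ∧ r • z ∈ LinearMap.range (wordSum C e m) := by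
  induction z using PiTensorProduct.induction_on with
  | add x y hx hy =>
    obtain ⟨r, hr, hx⟩ := hx
    obtain ⟨s, hs, hy⟩ := hy
    refine ⟨r * s, by simp [hr, hs], ?_⟩
    rw [smul_add]
    refine add_mem ?_ ?_
    · rw [mul_comm, mul_smul]
      exact Submodule.smul_mem _ _ hx
    · rw [mul_smul]
      exact Submodule.smul_mem _ _ hy
  | smul_tprod a x =>
    choose r hr hx using fun i : Fin m => he (x i.succ)
    refine ⟨∏ i, r i, by simp [map_prod, Finset.prod_ne_zero_iff, hr], ?_⟩
    rw [smul_comm]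
    refine Submodule.smul_mem _ _ ?_
    have h := map_mem_of_mem_span_range
      ((PiTensorProduct.tprod C : MultilinearMap C (fun _ : Fin (m + 1) => B) _).curryLeft (x 0))
      e (LinearMap.range (wordSum C e m))
      (fun w => ⟨Finsupp.single w (x 0), wordSum_single e w (x 0)⟩) hx
    rw [MultilinearMap.map_smul_univ, MultilinearMap.curryLeft_apply] at h
    have h1 : (Fin.cons (x 0) fun i : Fin m => x i.succ : Fin (m + 1) → B) = x :=
      Fin.cons_self_tail x
    rwa [h1] at h

variable {L : Type*} [CommRing L] [Algebra C L]

/-- By duality of `c` and `e`, every word other than `w` has a letter at which the product vanishes.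
-/
theorem wordFunctional_wordSum {c : Option ι → B →ₗ[C] L} {e : ι → B}
    (hce : ∀ i i', c (some i) (e i') = open Classical in if i' = i then 1 else 0) {m : ℕ}
    (f : (Fin m → ι) →₀ B) (w : Fin m → ι) :
    wordFunctional c (Fin.cons none (some ∘ w) : Fin (m + 1) → Option ι) (wordSum C e m f) =
      c none (f w) := by
  classical
  induction f using Finsupp.induction_linear with
  | zero => simp
  | add f g hf hg => rw [map_add, map_add, hf, hg, Finsupp.add_apply, map_add]
  | single w' b =>
    rw [wordSum_single, wordFunctional_tprod, Fin.prod_univ_succ, Finsupp.single_apply]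
    simp only [Fin.cons_zero, Fin.cons_succ, Function.comp_apply, hce]
    split_ifs with h
    · simp [h]
    · obtain ⟨i, hi⟩ := Function.ne_iff.mp h
      rw [map_zero, Finset.prod_eq_zero (Finset.mem_univ i) (by simp [hi]), mul_zero]

theorem IsWord.exists_eq_cons {m : ℕ} {u : Fin (m + 1) → Option ι} (hu : IsWord none u) :
    ∃ w : Fin m → ι, u = Fin.cons none (some ∘ w) := by
  choose w hw using fun i : Fin m =>
    Option.ne_none_iff_exists'.mp ((hu i.succ).not.mpr (Fin.succ_ne_zero i))
  refine ⟨w, funext fun i => ?_⟩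
  refine Fin.cases ?_ (fun i => ?_) i
  · exact (hu 0).mpr rfl
  · exact hw i

theorem isWord_cons {m : ℕ} (w : Fin m → ι) :
    IsWord none (Fin.cons none (some ∘ w) : Fin (m + 1) → Option ι) := by
  intro i
  refine Fin.cases ?_ (fun i => ?_) i <;> simp

/-- Some multiple `r • a` is `wordSum C e m f`. Torsion-freeness makes `f` nonzero, and since `r` is
nonzero in `L`, the words with nonzero functional at `a` are exactly those in the finite support of
`f`. -/
theorem exists_isLeadingWord [IsDomain B] [IsDomain L] [LinearOrder (Option ι)]
    {c : Option ι → B →ₗ[C] L} {e : ι → B}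
    (hce : ∀ i i', c (some i) (e i') = open Classical in if i' = i then 1 else 0)
    (hc : Function.Injective (c none)) (hCL : ∀ r : C, algebraMap C L r = 0 → algebraMap C B r = 0)
    (he : ∀ b, ∃ r : C, algebraMap C B r ≠ 0 ∧ r • b ∈ Submodule.span C (Set.range e)) {m : ℕ}
    (htf : ∀ (r : C) (z : ⨂[C]^(m + 1) B), algebraMap C B r ≠ 0 → r • z = 0 → z = 0)
    {a : ⨂[C]^(m + 1) B} (ha : a ≠ 0) : ∃ u, IsLeadingWord c none a u := by
  classical
  obtain ⟨r, hr, f, hf⟩ := exists_smul_mem_range_wordSum he a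
  have hne : f.support.Nonempty := by
    rw [Finset.nonempty_iff_ne_empty, ne_eq, Finsupp.support_eq_empty]
    rintro rfl
    exact ha (htf r a hr (by rw [← hf, map_zero]))
  have hiff : ∀ w : Fin m → ι,
      wordFunctional c (Fin.cons none (some ∘ w) : Fin (m + 1) → Option ι) a ≠ 0 ↔
        w ∈ f.support := by
    intro w
    have h := wordFunctional_wordSum hce f w
    rw [hf, map_smul, Algebra.smul_def] at h
    rw [Finsupp.mem_support_iff, not_iff_not, ← map_eq_zero_iff _ hc, ← h, mul_eq_zero,
      or_iff_right fun h0 => hr (hCL r h0)]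
  obtain ⟨w, hw, hmax⟩ := Finset.exists_max_image f.support
    (fun w => toLex (Fin.cons none (some ∘ w) : Fin (m + 1) → Option ι)) hne
  refine ⟨_, isWord_cons w, (hiff w).mpr hw, fun u' hu' h => ?_⟩
  obtain ⟨w', rfl⟩ := hu'.exists_eq_cons
  exact hmax w' ((hiff w').mp h)

end Words

theorem Sha.isDomain {C : Type u} [CommRing C] {lam : C} {B : Type v} [CommRing B] [Algebra C B]
    [IsDomain B] [CharZero B]
    (htf : ∀ (m : ℕ) (r : C) (z : ⨂[C]^(m + 1) B), algebraMap C B r ≠ 0 → r • z = 0 → z = 0) :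
    IsDomain (Sha C lam B) := by
  have hinj : Function.Injective (algebraMap B (FractionRing B)) :=
    IsFractionRing.injective B (FractionRing B)
  obtain ⟨ι, e, c, hce, he⟩ := exists_dual_family C hinj
  have : CharZero (FractionRing B) := charZero_of_injective_algebraMap hinj
  -- The extra letter `none` marks the leading factor, on which the multiplicative inclusion into
  -- the fraction field is used in place of a coordinate.
  let c' : Option ι → B →ₗ[C] FractionRing B := fun o =>
    o.elim (IsScalarTower.toAlgHom C B (FractionRing B)).toLinearMap c
  -- Any linear order on the letters would do.
  let _ : LinearOrder (Option ι) := IsWellOrder.linearOrder WellOrderingRel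
  have h0 : ∀ a b, c' none (a * b) = c' none a * c' none b := fun a b => map_mul (algebraMap B _) a b
  have := noZeroDivisors_of_exists_isLeadingWord (lam := lam) h0 fun m a ha =>
    exists_isLeadingWord (c := c') hce hinj (fun r hr => hinj (by
      rwa [map_zero, ← IsScalarTower.algebraMap_apply])) he (htf m) ha
  have := Sha.nontrivial (C := C) (lam := lam) (A := B)
  exact NoZeroDivisors.to_isDomain _

/-! ### Necessity of the two conditions -/

namespace Stuffle

theorem le_k {m n : ℕ} (s : Stuffle m n) : n ≤ s.k := by
  simpa using Fintype.card_le_of_injective _ s.monoG.injective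

/-- Without merging, the range of `G` is the complement of the position of the single letter, and an
increasing map is determined by its range. -/
theorem eq_of_F_one_eq {n : ℕ} {s s' : Stuffle 1 n} (hk : s.k = 1 + n) (hk' : s'.k = 1 + n)
    (h : (s.F 1 : ℕ) = s'.F 1) : s = s' := by
  have key : ∀ t : Stuffle 1 n, t.k = 1 + n → Set.range t.G = {t.F 1}ᶜ := by
    intro t ht
    ext q
    rw [Set.mem_compl_singleton_iff]
    constructor
    · rintro ⟨i, rfl⟩
      induction i using Fin.cases with
      | zero => rw [t.G0]; exact (t.F_succ_ne_zero 0).symm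
      | succ i => exact (t.F_succ_ne_G_succ ht 0 i).symm
    · intro hq
      rcases t.surj q with ⟨i, rfl⟩ | hi
      · induction i using Fin.cases with
        | zero => exact ⟨0, by rw [t.F0, t.G0]⟩
        | succ i => exact absurd (by rw [Subsingleton.elim i 0]; rfl) hq
      · exact hi
  have h1 := key s hk
  have h2 := key s' hk'
  refine ext_val (fun i => ?_) fun i => ?_
  · induction i using Fin.cases with
    | zero => rw [s.F0, s'.F0, Fin.val_zero, Fin.val_zero]
    | succ i =>
      rw [Subsingleton.elim i 0]
      exact h
  · obtain ⟨k, F, G, mF, mG, F0, G0, sj⟩ := s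
    obtain ⟨k', F', G', mF', mG', F0', G0', sj'⟩ := s'
    dsimp only at hk hk' h h1 h2 ⊢
    subst hk hk'
    rw [Fin.ext h, ← h2] at h1
    rw [(StrictMono.range_inj mG mG').mp h1]

/-- The shuffle of one letter with `n` letters that puts the letter at the position `p + 1`. -/
def insertAt {n : ℕ} (p : Fin (n + 1)) : Stuffle 1 n where
  k := n + 1
  F := Fin.cons 0 fun _ => p.succ
  G := p.succ.succAbove
  monoF := MixableShuffle.strictMono_cons (Subsingleton.strictMono _)
  monoG := Fin.strictMono_succAbove _
  F0 := rfl
  G0 := Fin.succAbove_ne_zero_zero (Fin.succ_ne_zero p)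
  surj q := by
    by_cases hq : q = p.succ
    · exact Or.inl ⟨1, hq.symm⟩
    · exact Or.inr (Fin.exists_succAbove_eq hq)

theorem card_filter_k_eq (n : ℕ) :
    (Finset.univ.filter fun s : Stuffle 1 n => s.k = 1 + n).card = n + 1 := by
  rw [← Finset.card_range (n + 1)]
  -- The single letter takes one of the positions `1, …, n + 1`, since position `0` is reserved for
  -- the leading factor; hence the shift by one.
  refine Finset.card_bij (fun s _ => (s.F 1 : ℕ) - 1) (fun s hs => ?_) (fun s hs s' hs' h => ?_)
    fun p hp => ?_
  · have := (Finset.mem_filter.mp hs).2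
    have := (s.F 1).isLt
    exact Finset.mem_range.mpr (by omega)
  · have h1 := Fin.val_ne_zero_iff.mpr (s.F_succ_ne_zero 0)
    have h2 := Fin.val_ne_zero_iff.mpr (s'.F_succ_ne_zero 0)
    rw [Fin.succ_zero_eq_one] at h1 h2
    exact eq_of_F_one_eq (Finset.mem_filter.mp hs).2 (Finset.mem_filter.mp hs').2 (by omega)
  · refine ⟨insertAt ⟨p, Finset.mem_range.mp hp⟩,
      Finset.mem_filter.mpr ⟨Finset.mem_univ _, add_comm n 1⟩, rfl⟩

end Stuffle

namespace Sha

variable {C : Type u} [CommRing C] {lam : C} {B : Type v} [CommRing B] [Algebra C B]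

theorem natCast_eq_j (n : ℕ) : (n : Sha C lam B) = j C lam (n : B) := by
  induction n with
  | zero => rw [Nat.cast_zero, Nat.cast_zero, ← sub_self (0 : B), j_sub, sub_self]
  | succ n ih =>
    rw [Nat.cast_succ, Nat.cast_succ, j_add, ih]
    rfl

/-- The pure tensor `1 ⊗ … ⊗ 1` with `n + 1` factors. -/
noncomputable def ones (C : Type u) [CommRing C] (lam : C) (B : Type v) [CommRing B] [Algebra C B]
    (n : ℕ) : Sha C lam B :=
  pure C lam (k := n) 1

/-- The `n + 1` shuffles without merging all give `ones C lam B (n + 1)`. Every other stuffle has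
`s.k = n` and contributes `lam • ones C lam B n`; how many there are is irrelevant later. -/
theorem exists_ones_one_mul_ones (n : ℕ) : ∃ r : C,
    ones C lam B 1 * ones C lam B n =
      ((n + 1 : ℕ) : Sha C lam B) * ones C lam B (n + 1) + r • ones C lam B n := by
  refine ⟨((Finset.univ.filter fun s : Stuffle 1 n => ¬ s.k = 1 + n).card : C) * lam, ?_⟩
  rw [ones, ones, pure_mul_pure_stuffle]
  simp only [push_one, mul_one]
  change ∑ s : Stuffle 1 n, lam ^ (1 + n - s.k) • ones C lam B s.k = _
  rw [← Finset.sum_filter_add_sum_filter_not Finset.univ fun s : Stuffle 1 n => s.k = 1 + n]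
  congr 1
  · rw [Finset.sum_congr rfl (g := fun _ => ones C lam B (n + 1)), Finset.sum_const,
      Stuffle.card_filter_k_eq, nsmul_eq_mul]
    intro s hs
    rw [(Finset.mem_filter.mp hs).2, Nat.sub_self, pow_zero, one_smul, add_comm 1 n]
  · rw [Finset.sum_congr rfl (g := fun _ => lam • ones C lam B n), Finset.sum_const,
      mul_smul, Nat.cast_smul_eq_nsmul]
    · rfl
    intro s hs
    have h1 := (Finset.mem_filter.mp hs).2
    have h2 := s.k_le
    have h3 := s.le_k
    have h4 : s.k = n := by omega
    rw [h4, Nat.add_sub_cancel, pow_one]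

theorem charZero_of_isDomain [IsDomain (Sha C lam B)] [Nontrivial B] : CharZero B := by
  let φ := coeff lam (fun _ : Unit => LinearMap.id (R := C) (M := B)) 1 fun _ => ()
  -- The functional `φ` multiplies the two factors of the component in degree `1`, so it sends `1 ⊗
  -- 1` to `1` and ignores `r • 1`.
  have hφ : ∀ r : C, ones C lam B 1 - r • 1 ≠ 0 := by
    intro r h
    have h1 := congrArg φ h
    rw [map_sub, map_smul, map_zero, ones, coeff_pure, one_def, pure,
      coeff_incl_of_ne _ zero_ne_one, smul_zero, sub_zero] at h1
    simp at h1
  have key : ∀ n : ℕ, ((n.factorial : ℕ) : Sha C lam B) * ones C lam B n ≠ 0 := by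
    intro n
    induction n with
    | zero =>
      rw [Nat.factorial_zero, Nat.cast_one, one_mul]
      exact one_ne_zero
    | succ n ih =>
      obtain ⟨r, hr⟩ := exists_ones_one_mul_ones (lam := lam) (B := B) n
      have h : (((n + 1).factorial : ℕ) : Sha C lam B) * ones C lam B (n + 1) =
          (ones C lam B 1 - r • 1) * (((n.factorial : ℕ) : Sha C lam B) * ones C lam B n) := by
        rw [sub_mul, mul_left_comm, hr, Sha.smul_mul, one_mul, Nat.factorial_succ, Nat.cast_mul,
          mul_add, mul_smul_comm, add_sub_cancel_right]
        ring
      rw [h]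
      exact mul_ne_zero (hφ r) ih
  -- A positive `n` that vanishes in `B` vanishes in the shuffle algebra, and with it `n!`, which
  -- contradicts `key`.
  refine charZero_of_inj_zero fun n hn => ?_
  by_contra h0
  have h1 : (n : Sha C lam B) = 0 := by
    rw [natCast_eq_j, hn, ← Nat.cast_zero, ← natCast_eq_j, Nat.cast_zero]
  have h2 : ((n.factorial : ℕ) : Sha C lam B) = 0 := by
    obtain ⟨d, hd⟩ := Nat.dvd_factorial (Nat.pos_of_ne_zero h0) le_rfl
    rw [hd, Nat.cast_mul, h1, zero_mul]
  exact key n (by rw [h2, zero_mul])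

theorem eq_zero_of_smul_eq_zero [IsDomain (Sha C lam B)] {k : ℕ} {r : C}
    (hr : algebraMap C B r ≠ 0) {x : ⨂[C]^(k + 1) B} (hx : r • x = 0) : x = 0 := by
  have h : (r • (1 : Sha C lam B)) * incl C lam B k x = 0 := by
    rw [Sha.smul_mul, one_mul, ← map_smul, hx, map_zero]
  rcases mul_eq_zero.mp h with h | h
  · refine absurd ?_ hr
    have h1 := congrArg
      (coeff lam (fun _ : Unit => LinearMap.id (R := C) (M := B)) 0 fun _ => ()) h
    rw [map_smul, one_def, coeff_pure, map_zero] at h1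
    simpa [Algebra.smul_def] using h1
  · exact DirectSum.of_injective (β := fun k => ⨂[C]^(k + 1) B) k (h.trans (map_zero _).symm)

end Sha

end BaxterAlgebra

theorem mainTheorem6 {C : Type*} [CommRing C] (lam : C) {A : Type*} [CommRing A] [Algebra C A]
    (I : Ideal A) (hI : I.IsPrime) :
    (BaxterAlgebra.baxterIdealSpan (BaxterAlgebra.Sha.P C lam A)
        (BaxterAlgebra.Sha.j C lam '' (I : Set A))).IsPrime ↔
      CharZero (A ⧸ I) ∧
        ∀ n : ℕ, 1 ≤ n →
          BaxterAlgebra.torsionModulo (RingHom.ker (algebraMap C (A ⧸ I)))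
            (⨂[C]^n (A ⧸ I)) = {0} := by
  have hdom : IsDomain (A ⧸ I) := Ideal.Quotient.isDomain I
  rw [BaxterAlgebra.Sha.isPrime_baxterIdealSpan_iff]
  refine ⟨fun h => ⟨BaxterAlgebra.Sha.charZero_of_isDomain (lam := lam), fun n hn => ?_⟩,
    fun ⟨hchar, htf⟩ => BaxterAlgebra.Sha.isDomain fun m r z hr hz => ?_⟩
  · obtain ⟨k, rfl⟩ := Nat.exists_eq_add_of_le' hn
    refine Set.Subset.antisymm ?_ ?_
    · rintro x ⟨r, hr, hx⟩
      exact BaxterAlgebra.Sha.eq_zero_of_smul_eq_zero (lam := lam) (RingHom.mem_ker.not.mp hr) hx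
    · rintro _ rfl
      -- The scalar `1` lies outside the kernel because `A ⧸ I` is nontrivial.
      exact ⟨1, by simp [RingHom.mem_ker], smul_zero _⟩
  · have h : z ∈ BaxterAlgebra.torsionModulo (RingHom.ker (algebraMap C (A ⧸ I)))
        (⨂[C]^(m + 1) (A ⧸ I)) := ⟨r, RingHom.mem_ker.not.mpr hr, hz⟩
    rwa [htf (m + 1) (Nat.le_add_left 1 m)] at h
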